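/- **Setting.** Let $\mathcal G$ be a connected, locally finite metric graph with countable vertex set, each edge $e$ being identified with an interval $[0,l_e]$, $0<l_e<\infty$, and with the geodesic distance. A set of boundary vertices containing all vertices of degree one is fixed; the other vertices are interior, and $\mathcal G_{int}$ is $\mathcal G$ without the boundary vertices. Let $\overline{\mathcal G}$ be the metric completion and $\partial\overline{\mathcal G}=\overline{\mathcal G}\setminus\mathcal G_{int}$. Assume that $\overline{\mathcal G}$ is compact and $\partial\overline{\mathcal G}$ is totally disconnected. $L^2(\mathcal G)=\bigoplus_e L^2[0,l_e]$ is the real Lebesgue space with inner product $\langle\cdot,\cdot\rangle_2$; $N_\epsilon(A)$ denotes the open $\epsilon$-neighborhood of $A\subset\overline{\mathcal G}$; the volume of a set is its Lebesgue measure. $\mathcal D_{max}$ is the set of continuous $f:\mathcal G\to\mathbb R$ that are differentiable on each closed edge with absolutely continuous derivative, with $f,f''\in L^2(\mathcal G)$, and that satisfy the Kirchhoff condition $\sum_{e\sim v}\partial_\nu f_e(v)=0$ at each interior vertex $v$, where $\partial_\nu f_e(v)$ is the derivative at $v$ in the direction from $v$ into $e$. A function $h:\overline{\mathcal G}\to\mathbb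 R$ is harmonic if it is continuous, affine on each edge, and satisfies the Kirchhoff condition at each interior vertex; it has finite energy if moreover $h'\in L^2(\mathcal G)$. **Boundary data.** Let $N\ge 1$, $\delta>0$, and let $E_0,E_1,\dots,E_N$ be a partition of $\partial\overline{\mathcal G}$ into clopen subsets, with $E_1,\dots,E_N$ nonempty ($E_0$ may be empty), such that the sets $N_\delta(E_n)$, $0\le n\le N$, are pairwise disjoint and have finite volume for $n\ge 1$. For $n=1,\dots,N$ let $k_n$ be a harmonic function of finite energy such that (i) $k_n$ has a constant value $C_n>0$ on $E_n$; (ii) there are $\epsilon,\eta>0$ such that for all $t\ne C_n$ with $|t-C_n|<\eta$, the function $k_n$ has positive normal derivative at the points of the level set $\{k_n=t\}\cap N_\epsilon(E_n)$ that lie inside edges. Here the normal direction points out of the part of $\overline{\mathcal G}$ that the level set cuts off around $E_n$, i.e. out of the union of the components of $\overline{\mathcal G}\setminus\{k_n=t\}$ that meet $E_n$ (nothing is required at points of the level set not adjacent to this union); and such level sets exist near $E_n$, i.e. $k_n$ is not constant on any neighborhood $N_r(E_n)$, $r>0$. Let $\mathcal E(0)$ consist of $E_1,\dots,E_N$ and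 of $E_0$ if $E_0\neq\emptyset$; given the finite partition $\mathcal E(j)$ of $\partial\overline{\mathcal G}$ into nonempty clopen sets, let $\mathcal E(j+1)$ be obtained by splitting each member of $\mathcal E(j)$ into two disjoint nonempty clopen sets, keeping those members that cannot be split. Let $\mathcal D_{\mathcal E(j),\mathcal K(j)}$ be the set of $\phi\in\mathcal D_{max}$ for which there is $\epsilon\in(0,\delta)$ with $\phi=0$ on $\mathcal G\cap N_\epsilon(E_0)$ and such that for every $A\in\mathcal E(j)$ with $A\subset E_n$, $n\ge 1$, there is a constant $c_A$ with $\phi=c_Ak_n$ on $\mathcal G\cap N_\epsilon(A)$. Let $S_{\mathcal E(j),\mathcal K(j)}$ be the operator $-D^2$ in $L^2(\mathcal G)$ with domain $\mathcal D_{\mathcal E(j),\mathcal K(j)}$, and $S_U$ the operator $-D^2$ with domain $\bigcup_j\mathcal D_{\mathcal E(j),\mathcal K(j)}$. **Theorem.** For every $j$ the operator $S_{\mathcal E(j),\mathcal K(j)}$ is nonnegative, i.e. $\langle S_{\mathcal E(j),\mathcal K(j)}f,f\rangle_2\ge 0$ for all $f$ in its domain, and $S_U$ is nonnegative. For every $j$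 there is a function $f$ in the domain of $S_{\mathcal E(j),\mathcal K(j)}$ with $f'\in L^2(\mathcal G)$ and $$\langle S_{\mathcal E(j),\mathcal K(j)}f,f\rangle_2>\int_{\mathcal G}(f')^2 .$$ -/

import Mathlib

open Set Filter Topology MeasureTheory

/-- A connected, locally finite metric graph with vertex set `V` and edge set `E`, together with
its set of boundary vertices.  The edge `e` is identified with the interval `[0, len e]`, where `0`
corresponds to `src e` and `len e` to `tgt e`.  Multiple edges and loops are allowed. -/
structure MetricGraph (V : Type*) (E : Type*) where
  src : E → V
  tgt : E → V
  len : E → ℝ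
  len_pos : ∀ e, 0 < len e
  locallyFinite : ∀ v, {e | src e = v ∨ tgt e = v}.Finite
  nonempty : Nonempty V
  connected : ∀ v w, Relation.ReflTransGen
    (fun a b => ∃ e, (src e = a ∧ tgt e = b) ∨ (src e = b ∧ tgt e = a)) v w
  /-- the boundary vertices -/
  bdry : Set V
  /-- a vertex of degree one (the degree counts the ends of edges at `v`) is a boundary vertex -/
  mem_bdry_of_degree_one : ∀ v,
    {e | src e = v}.ncard + {e | tgt e = v}.ncard = 1 → v ∈ bdry

namespace MetricGraph

noncomputable section

variable {V : Type*} {E : Type*} (G : MetricGraph V E)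

/-- The points of the metric graph: the vertices and the points of the open edges. -/
inductive Point : Type _
  | vtx (v : V) : Point
  | inner (e : E) (t : ℝ) (ht : t ∈ Ioo 0 (G.len e)) : Point

/-- A vertex as a point of the graph. -/
def vtx (v : V) : G.Point := Point.vtx v

open Classical in
/-- The point of the closed edge `e` with coordinate `t ∈ [0, len e]`
(for `t` outside this interval, the nearest end of the edge). -/
def pt (e : E) (t : ℝ) : G.Point :=
  if h : t ∈ Ioo (0 : ℝ) (G.len e) then Point.inner e t h
  else if t ≤ 0 then G.vtx (G.src e) else G.vtx (G.tgt e)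

/-- `G.HasPath x y L`: there is a path of length `L` from `x` to `y`, that is, a finite
concatenation of segments of closed edges, starting at `x` and ending at `y`. -/
inductive HasPath : G.Point → G.Point → ℝ → Prop
  | refl (x : G.Point) : HasPath x x 0
  | step (e : E) (s t : ℝ) (y : G.Point) (L : ℝ) (hs : s ∈ Icc 0 (G.len e))
      (ht : t ∈ Icc 0 (G.len e)) (h : HasPath (G.pt e t) y L) :
      HasPath (G.pt e s) y (|s - t| + L)

variable {G}

theorem pt_zero (e : E) : G.pt e 0 = G.vtx (G.src e) := by
  simp [pt]

theorem pt_len (e : E) : G.pt e (G.len e) = G.vtx (G.tgt e) := by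
  have := G.len_pos e
  simp [pt, not_le.mpr this]

theorem HasPath.nonneg {x y : G.Point} {L : ℝ} (h : G.HasPath x y L) : 0 ≤ L := by
  induction h with
  | refl => exact le_rfl
  | step e s t y L hs ht h ih => positivity

theorem HasPath.trans {x y z : G.Point} {L M : ℝ} (h : G.HasPath x y L) (h' : G.HasPath y z M) :
    G.HasPath x z (L + M) := by
  induction h with
  | refl => simpa using h'
  | step e s t y L hs ht h ih =>
    rw [add_assoc]
    exact .step e s t z _ hs ht (ih h')

theorem HasPath.single (e : E) {s t : ℝ} (hs : s ∈ Icc 0 (G.len e)) (ht : t ∈ Icc 0 (G.len e)) :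
    G.HasPath (G.pt e s) (G.pt e t) |s - t| := by
  simpa using HasPath.step e s t (G.pt e t) 0 hs ht (.refl _)

theorem HasPath.symm {x y : G.Point} {L : ℝ} (h : G.HasPath x y L) : G.HasPath y x L := by
  induction h with
  | refl => exact .refl _
  | step e s t y L hs ht h ih =>
    have := ih.trans (HasPath.single e ht hs)
    rwa [abs_sub_comm, add_comm] at this

theorem exists_hasPath_vtx (v w : V) : ∃ L, G.HasPath (G.vtx v) (G.vtx w) L := by
  induction G.connected v w with
  | refl => exact ⟨0, .refl _⟩
  | tail _ hbc ih =>
    obtain ⟨L, hL⟩ := ih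
    obtain ⟨e, ⟨rfl, rfl⟩ | ⟨rfl, rfl⟩⟩ := hbc
    · have := HasPath.single (G := G) e (left_mem_Icc.2 (G.len_pos e).le)
        (right_mem_Icc.2 (G.len_pos e).le)
      rw [pt_zero, pt_len] at this
      exact ⟨_, hL.trans this⟩
    · have := HasPath.single (G := G) e (right_mem_Icc.2 (G.len_pos e).le)
        (left_mem_Icc.2 (G.len_pos e).le)
      rw [pt_zero, pt_len] at this
      exact ⟨_, hL.trans this⟩

theorem exists_hasPath_to_vtx (x : G.Point) : ∃ v L, G.HasPath x (G.vtx v) L := by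
  rcases x with v | ⟨e, t, ht⟩
  · exact ⟨v, 0, .refl _⟩
  · have h := HasPath.single (G := G) e (Ioo_subset_Icc_self ht)
      (left_mem_Icc.2 (G.len_pos e).le)
    rw [pt_zero] at h
    have e1 : G.pt e t = Point.inner e t ht := dif_pos ht
    rw [e1] at h
    exact ⟨_, _, h⟩

theorem exists_hasPath (x y : G.Point) : ∃ L, G.HasPath x y L := by
  obtain ⟨v, L, h⟩ := exists_hasPath_to_vtx x
  obtain ⟨w, M, h'⟩ := exists_hasPath_to_vtx y
  obtain ⟨K, h''⟩ := exists_hasPath_vtx (G := G) v w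
  exact ⟨_, (h.trans h'').trans h'.symm⟩

theorem bddBelow_hasPath (x y : G.Point) : BddBelow {L | G.HasPath x y L} :=
  ⟨0, fun _ h => HasPath.nonneg h⟩

/-- The geodesic distance: the infimum of the lengths of the paths that join two points. -/
instance : PseudoMetricSpace G.Point where
  dist x y := sInf {L | G.HasPath x y L}
  dist_self x := le_antisymm (csInf_le (bddBelow_hasPath x x) (.refl x))
    (le_csInf ⟨0, .refl x⟩ fun _ h => HasPath.nonneg h)
  dist_comm x y := congrArg sInf (Set.ext fun _ => ⟨HasPath.symm, HasPath.symm⟩)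
  dist_triangle x y z := by
    refine le_of_forall_pos_lt_add fun ε hε => ?_
    obtain ⟨L, hL, hL'⟩ := exists_lt_of_csInf_lt (exists_hasPath x y)
      (lt_add_of_pos_right (sInf {L | G.HasPath x y L}) (half_pos hε))
    obtain ⟨M, hM, hM'⟩ := exists_lt_of_csInf_lt (exists_hasPath y z)
      (lt_add_of_pos_right (sInf {L | G.HasPath y z L}) (half_pos hε))
    have := csInf_le (bddBelow_hasPath x z) (HasPath.trans hL hM)
    linarith

variable (G)

/-- The metric completion of the graph. -/
abbrev Completion : Type _ := UniformSpace.Completion G.Point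

/-- The point of the edge `e` with coordinate `t`, as a point of the completion. -/
def cpt (e : E) (t : ℝ) : G.Completion := (G.pt e t : G.Completion)

/-- The interior of the graph: all points except the boundary vertices. -/
def interiorPts : Set G.Point := (G.vtx '' G.bdry)ᶜ

/-- The boundary of the completion: the complement of the interior of the graph. -/
def boundary : Set G.Completion :=
  ((fun x : G.Point => (x : G.Completion)) '' G.interiorPts)ᶜ

/-- `A` is a clopen subset of the boundary of the completion. -/
def IsBdryClopen (A : Set G.Completion) : Prop :=
  A ⊆ G.boundary ∧ IsClopen {p : G.boundary | (p : G.Completion) ∈ A}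

/-! ### Functions on the graph, given by their components on the edges -/

/-- The components `f_e` of a function `f` on the graph, as one function of `(e, t)`. -/
def comp (f : G.Point → ℝ) : (Σ _ : E, ℝ) → ℝ := fun q => f (G.pt q.1 q.2)

/-- Edgewise differentiation. -/
def _root_.edgeDeriv {E : Type*} (g : (Σ _ : E, ℝ) → ℝ) : (Σ _ : E, ℝ) → ℝ :=
  fun q => deriv (fun t => g ⟨q.1, t⟩) q.2

/-- Lebesgue measure on the graph: the sum of the Lebesgue measures of the intervals
`[0, len e]`. -/
def edgeMeasure : Measure (Σ _ : E, ℝ) :=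
  Measure.sum fun e => (volume.restrict (Icc 0 (G.len e))).map (Sigma.mk e)

/-- The Hilbert space `L²(G)`. -/
abbrev L2 : Type _ := Lp ℝ 2 G.edgeMeasure

/-- The volume of (the part in the graph of) a set in the completion. -/
def vol (A : Set G.Completion) : ENNReal := G.edgeMeasure {q | G.cpt q.1 q.2 ∈ A}

/-- The sum over the edge ends at `v` of the derivatives of `f` at `v`, each taken in the direction
that points from `v` into the edge. -/
def vertexFlux (f : G.Point → ℝ) (v : V) : ℝ :=
  (∑ᶠ (e : E) (_ : G.src e = v), derivWithin (fun t => f (G.pt e t)) (Icc 0 (G.len e)) 0) -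
  ∑ᶠ (e : E) (_ : G.tgt e = v),
    derivWithin (fun t => f (G.pt e t)) (Icc 0 (G.len e)) (G.len e)

/-- The maximal domain of `-D²`. -/
structure MemDMax (f : G.Point → ℝ) : Prop where
  continuous : Continuous f
  differentiableOn : ∀ e, DifferentiableOn ℝ (fun t => f (G.pt e t)) (Icc 0 (G.len e))
  absCont : ∀ e, AbsolutelyContinuousOnInterval
    (derivWithin (fun t => f (G.pt e t)) (Icc 0 (G.len e))) 0 (G.len e)
  memLp : MemLp (G.comp f) 2 G.edgeMeasure
  memLp_deriv2 : MemLp (edgeDeriv (edgeDeriv (G.comp f))) 2 G.edgeMeasure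
  kirchhoff : ∀ v, v ∉ G.bdry → G.vertexFlux f v = 0

/-- The class in `L²(G)` of a function of the maximal domain. -/
def toL2 {f : G.Point → ℝ} (hf : G.MemDMax f) : G.L2 := hf.memLp.toLp _

/-- `-D² f` as an element of `L²(G)`, for `f` in the maximal domain. -/
def negD2 {f : G.Point → ℝ} (hf : G.MemDMax f) : G.L2 := -hf.memLp_deriv2.toLp _

/-- The operator in `L²(G)` that acts by `-D²` on the domain `D`
(a set of functions in the maximal domain), given by its graph. -/
def operatorOn (D : Set (G.Point → ℝ)) : Set (G.L2 × G.L2) :=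
  {p | ∃ f ∈ D, ∃ hf : G.MemDMax f, p = (G.toL2 hf, G.negD2 hf)}

/-- An operator (given by its graph) is nonnegative: `⟨S u, u⟩ ≥ 0` for all `u` in its domain. -/
def IsNonnegOp (S : Set (G.L2 × G.L2)) : Prop :=
  ∀ p ∈ S, 0 ≤ inner ℝ p.2 p.1

/-! ### Harmonic functions of finite energy -/

/-- Harmonic functions on the completion: continuous, affine on each edge,
and with the Kirchhoff condition at each interior vertex. -/
structure IsHarmonic (h : G.Completion → ℝ) : Prop where
  continuous : Continuous h
  affine : ∀ e, ∃ a b : ℝ, ∀ t ∈ Icc 0 (G.len e), h (G.cpt e t) = a + b * t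
  kirchhoff : ∀ v, v ∉ G.bdry → G.vertexFlux (fun x => h x) v = 0

/-- The energy space: continuous functions on the completion, absolutely continuous on each edge,
with square integrable derivative. -/
structure MemH1 (h : G.Completion → ℝ) : Prop where
  continuous : Continuous h
  absCont : ∀ e, AbsolutelyContinuousOnInterval (fun t => h (G.cpt e t)) 0 (G.len e)
  memLp_deriv : MemLp (edgeDeriv (G.comp fun x => h x)) 2 G.edgeMeasure

/-- The part of the completion that the level set `{h = t}` cuts off around `A`: the union of the
connected components of the complement of the level set that meet `A`. -/
def cutOff (h : G.Completion → ℝ) (A : Set G.Completion) (t : ℝ) : Set G.Completion :=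
  ⋃ p ∈ A, connectedComponentIn {y | h y ≠ t} p

/-- For `t` close to `C` (and different from `C`), `h` has positive normal derivative on the part of
the level set `{h = t}` near `A`.  The normal at a point of the level set inside an edge points away
from the part that the level set cuts off around `A`, into the rest of the graph. -/
def PosNormalDeriv (h : G.Completion → ℝ) (A : Set G.Completion) (C : ℝ) : Prop :=
  ∃ ε > 0, ∃ η > 0, ∀ t : ℝ, t ≠ C → |t - C| < η →
    ∀ e, ∀ s ∈ Ioo 0 (G.len e), G.cpt e s ∈ Metric.thickening ε A → h (G.cpt e s) = t →
      ((∀ᶠ r in 𝓝[<] s, G.cpt e r ∈ G.cutOff h A t) → 0 < deriv (fun r => h (G.cpt e r)) s) ∧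
      ((∀ᶠ r in 𝓝[>] s, G.cpt e r ∈ G.cutOff h A t) → 0 < -deriv (fun r => h (G.cpt e r)) s)

/-- The admissible boundary functions for the clopen set `A`: finite energy harmonic functions with
the constant value `C > 0` on `A` and positive normal derivative on the nearby level sets `{h = t}`
for `t` close to `C`.  The last field says that there are such level sets near `A`. -/
structure IsRobinFunction (h : G.Completion → ℝ) (A : Set G.Completion) (C : ℝ) : Prop where
  harmonic : G.IsHarmonic h
  finiteEnergy : G.MemH1 h
  pos : 0 < C
  eq_on : ∀ x ∈ A, h x = C
  posNormalDeriv : G.PosNormalDeriv h A C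
  nonconstant : ∀ ε > 0, ∃ x ∈ Metric.thickening ε A, h x ≠ C

/-! ### Partitions of the boundary and the domains -/

/-- `A` is the disjoint union of the nonempty clopen sets `B` and `B'`. -/
def IsSplit (A B B' : Set G.Completion) : Prop :=
  G.IsBdryClopen B ∧ G.IsBdryClopen B' ∧ B.Nonempty ∧ B'.Nonempty ∧ Disjoint B B' ∧ B ∪ B' = A

/-- `Q` arises from `P` by splitting each member of `P` into two nonempty disjoint clopen sets,
where the members that cannot be split are kept. -/
def IsSuccPartition (P Q : Set (Set G.Completion)) : Prop :=
  ∃ l r : Set G.Completion → Set G.Completion,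
    (∀ A ∈ P, G.IsSplit A (l A) (r A) ∨
      ((¬ ∃ B B', G.IsSplit A B B') ∧ l A = A ∧ r A = A)) ∧
    Q = l '' P ∪ r '' P

/-- The sets `F₀` and `F n` form a partition of the boundary into clopen sets with `F n` nonempty
(`F₀` is allowed to be empty), their `δ`-neighborhoods are pairwise disjoint,
and those of the `F n` have finite volume. -/
structure IsInitialPartition {N : ℕ} (F₀ : Set G.Completion) (F : Fin N → Set G.Completion)
    (δ : ℝ) : Prop where
  pos : 0 < δ
  clopen_zero : G.IsBdryClopen F₀
  clopen : ∀ n, G.IsBdryClopen (F n)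
  nonempty : ∀ n, (F n).Nonempty
  cover : F₀ ∪ ⋃ n, F n = G.boundary
  disjoint_zero : ∀ n, Disjoint (Metric.thickening δ F₀) (Metric.thickening δ (F n))
  disjoint : ∀ m n, m ≠ n → Disjoint (Metric.thickening δ (F m)) (Metric.thickening δ (F n))
  finite_vol : ∀ n, G.vol (Metric.thickening δ (F n)) < ⊤

/-- `P` is a sequence of successive partitions that starts with the partition into `F₀`
(if nonempty) and the `F n`. -/
def IsPartitionSequence {N : ℕ} (F₀ : Set G.Completion) (F : Fin N → Set G.Completion)
    (P : ℕ → Set (Set G.Completion)) : Prop :=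
  P 0 = insert F₀ (range F) \ {∅} ∧ ∀ j, G.IsSuccPartition (P j) (P (j + 1))

/-- The domain attached to a partition `Q` of the boundary that refines the partition into `F₀` and
the `F n`, and to functions `k n`, where `k n` is assigned to each member of `Q` inside `F n`:
the functions of the maximal domain that vanish near `F₀` and that near each `A ∈ Q` with `A ⊆ F n`
are a constant multiple of `k n`. -/
def domain {N : ℕ} (δ : ℝ) (F₀ : Set G.Completion) (F : Fin N → Set G.Completion)
    (k : Fin N → G.Completion → ℝ) (Q : Set (Set G.Completion)) : Set (G.Point → ℝ) :=
  {f | G.MemDMax f ∧ ∃ ε, 0 < ε ∧ ε < δ ∧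
    (∀ x : G.Point, (x : G.Completion) ∈ Metric.thickening ε F₀ → f x = 0) ∧
    ∀ A ∈ Q, ∀ n, A ⊆ F n → ∃ c : ℝ, ∀ x : G.Point,
      (x : G.Completion) ∈ Metric.thickening ε A → f x = c * k n x}

end

end MetricGraph

/-! Near the boundary a function f of the domain is 0 or a multiple c·k_n, hence affine on edges,
and by compactness only finitely many edges are not close to the boundary (`finite_farEdges`).
Green's formula on the edges therefore writes ⟨-D²f, f⟩ as a finite sum of edge energies and end
terms (`MemDMax.inner_eq_sum`). By the Kirchhoff conditions one may subtract from the vertex values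
of f in the end terms any finitely supported ψ that vanishes at the boundary vertices
(`MemDMax.inner_eq_sum_greenTerm`).

The normal derivative condition forces k_n ≥ C_n near E_n (`PosNormalDeriv.exists_forall_le`): a
path from E_n to a point with a smaller value would first cross some level t < C_n downwards,
against the sign of the normal derivative.

Take ψ = f away from the boundary and ψ = c·Φ(k_n) near E_n, where Φ (`truncation`) is nondecreasing
on [C_n, ∞), zero up to C_n + σ and the identity beyond C_n + σ₀. Its support is finite because k_n
tends uniformly to C_n at E_n. On an edge near E_n where k_n has slope b, the Green term is c²·b
times the increment of Φ(k_n), so it is nonnegative. On the finitely many remaining edges σ₀ is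
below every positive gap k_n - C_n at an end. So at such an end either ψ = f and the end term is
zero, or k_n = C_n, ψ = 0 and the end term is c²·C_n times the slope of k_n into the edge, which is
nonnegative at a minimum. Nonnegativity follows.

For the strict inequality let f be a cutoff of k_n. Once σ is small enough for a given edge, its
Green term is at least its energy (`IsLocallyMultiple.greenTerm_nonneg`). The jump of Φ by C_n at
C_n + σ₀ does not depend on σ: an edge of slope b across that level, or a remaining edge with an end
at the value C_n, gains C_n·|b| (`IsLocallyMultiple.exists_surplus`). Letting finite sets of edges
exhaust the graph, with σ depending on the set, gives ⟨-D²f, f⟩ ≥ ∫ (f')² + C_n·|b|. -/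

theorem Set.Finite.exists_pos_forall_le {ι : Type*} {s : Set ι} (hs : s.Finite) {f : ι → ℝ}
    (hf : ∀ i ∈ s, 0 < f i) : ∃ ρ > 0, ∀ i ∈ s, ρ ≤ f i := by
  rcases s.eq_empty_or_nonempty with rfl | hne
  · exact ⟨1, one_pos, by simp⟩
  · obtain ⟨i, hi, hmin⟩ := Set.exists_min_image s f hs hne
    exact ⟨f i, hf i hi, hmin⟩

namespace MetricGraph

variable {V E : Type*} {G : MetricGraph V E}

/-! ### Points, paths and distances -/

theorem pt_of_mem_Ioo {e : E} {t : ℝ} (h : t ∈ Ioo 0 (G.len e)) :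
    G.pt e t = Point.inner e t h := dif_pos h

theorem pt_of_nonpos {e : E} {t : ℝ} (h : t ≤ 0) : G.pt e t = G.vtx (G.src e) := by
  have : t ∉ Ioo 0 (G.len e) := fun h' => absurd h'.1 (not_lt.2 h)
  rw [pt, dif_neg this, if_pos h]

theorem pt_of_len_le {e : E} {t : ℝ} (h : G.len e ≤ t) : G.pt e t = G.vtx (G.tgt e) := by
  have : t ∉ Ioo 0 (G.len e) := fun h' => absurd h'.2 (not_lt.2 h)
  rw [pt, dif_neg this, if_neg (not_le.2 ((G.len_pos e).trans_le h))]

theorem dist_le_of_hasPath {x y : G.Point} {L : ℝ} (h : G.HasPath x y L) : dist x y ≤ L :=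
  csInf_le (bddBelow_hasPath x y) h

theorem exists_hasPath_lt {x y : G.Point} {r : ℝ} (h : dist x y < r) :
    ∃ L, G.HasPath x y L ∧ L < r :=
  exists_lt_of_csInf_lt (exists_hasPath x y) h

theorem dist_pt_le (e : E) {s t : ℝ} (hs : s ∈ Icc 0 (G.len e)) (ht : t ∈ Icc 0 (G.len e)) :
    dist (G.pt e s) (G.pt e t) ≤ |s - t| :=
  dist_le_of_hasPath (.single e hs ht)

theorem dist_cpt_le (e : E) {s t : ℝ} (hs : s ∈ Icc 0 (G.len e)) (ht : t ∈ Icc 0 (G.len e)) :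
    dist (G.cpt e s) (G.cpt e t) ≤ |s - t| := by
  rw [cpt, cpt, UniformSpace.Completion.dist_eq]
  exact dist_pt_le e hs ht

theorem continuousOn_cpt (e : E) : ContinuousOn (G.cpt e) (Icc 0 (G.len e)) := by
  have : LipschitzOnWith 1 (G.cpt e) (Icc 0 (G.len e)) :=
    LipschitzOnWith.of_dist_le_mul fun s hs t ht => by
      simpa [Real.dist_eq] using dist_cpt_le e hs ht
  exact this.continuousOn

theorem isPreconnected_cpt_image (e : E) {s t : ℝ} (hs : s ∈ Icc 0 (G.len e))
    (ht : t ∈ Icc 0 (G.len e)) : IsPreconnected (G.cpt e '' uIcc s t) :=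
  isPreconnected_uIcc.image _ ((continuousOn_cpt e).mono (uIcc_subset_Icc hs ht))

theorem exists_point_near (p : G.Completion) {r : ℝ} (hr : 0 < r) :
    ∃ z : G.Point, dist (z : G.Completion) p < r := by
  obtain ⟨z, hz⟩ := UniformSpace.Completion.denseRange_coe.exists_dist_lt p hr
  exact ⟨z, by rwa [dist_comm]⟩

/-- A path that starts at distance d from p and has length less than R - d never leaves the ball of
radius R; its segments are connected, so it stays in one component. -/
theorem HasPath.mem_connectedComponentIn {x y : G.Point} {L : ℝ} (h : G.HasPath x y L)
    {p : G.Completion} {R : ℝ} {U : Set G.Completion} (hU : Metric.ball p R ⊆ U)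
    (hL : dist (x : G.Completion) p + L < R) :
    (y : G.Completion) ∈ connectedComponentIn U (x : G.Completion) := by
  induction h with
  | refl x => exact _root_.mem_connectedComponentIn (hU (by simpa using hL))
  | step e s t y L hs ht h ih =>
    have hL0 := h.nonneg
    have hseg : G.cpt e '' uIcc s t ⊆ U := by
      rintro _ ⟨r, hr, rfl⟩
      refine hU (Metric.mem_ball.2 ?_)
      have h1 := dist_cpt_le e (uIcc_subset_Icc hs ht hr) hs
      have h2 := abs_sub_left_of_mem_uIcc hr
      have h3 := dist_triangle (G.cpt e r) (G.cpt e s) p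
      rw [abs_sub_comm t s] at h2
      change dist (G.cpt e s) p + _ < R at hL
      linarith
    have hmem : G.cpt e t ∈ connectedComponentIn U (G.cpt e s) :=
      (isPreconnected_cpt_image e hs ht).subset_connectedComponentIn
        (mem_image_of_mem _ left_mem_uIcc) hseg (mem_image_of_mem _ right_mem_uIcc)
    have h1 := dist_cpt_le e ht hs
    have h3 := dist_triangle (G.cpt e t) (G.cpt e s) p
    rw [abs_sub_comm t s] at h1
    have := ih (by change dist (G.cpt e s) p + _ < R at hL; change dist (G.cpt e t) p + _ < R
                   linarith)
    change (y : G.Completion) ∈ connectedComponentIn U (G.cpt e s)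
    rwa [connectedComponentIn_eq hmem]

/-- The completion is locally connected: points of the graph close to `p` lie in the component
of `p`. -/
theorem mem_connectedComponentIn_of_dist_lt {p : G.Completion} {R : ℝ} {U : Set G.Completion}
    (hU : Metric.ball p R ⊆ U) {z : G.Point} (hz : dist (z : G.Completion) p < R / 3) :
    (z : G.Completion) ∈ connectedComponentIn U p := by
  have hR : 0 < R := by have := dist_nonneg (x := (z : G.Completion)) (y := p); linarith
  have hzU : (z : G.Completion) ∈ U := hU (Metric.mem_ball.2 (by linarith))
  set S := connectedComponentIn U (z : G.Completion)
  -- Two graph points within R/3 of p are joined by a path shorter than 2R/3, which stays within R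
  -- of p.
  have hS : ∀ w : G.Point, dist (w : G.Completion) p < R / 3 → (w : G.Completion) ∈ S := by
    intro w hw
    have h1 : dist z w < 2 * R / 3 := by
      rw [← UniformSpace.Completion.dist_eq]
      have := dist_triangle_right (z : G.Completion) w p
      linarith
    obtain ⟨L, hL, hL'⟩ := exists_hasPath_lt h1
    exact hL.mem_connectedComponentIn hU (by linarith)
  -- The point p need not lie on the graph, so no path reaches it; it is added to the connected set
  -- S as a limit point.
  have hp : p ∈ closure S := by
    refine Metric.mem_closure_iff.2 fun η hη => ?_
    obtain ⟨w, hw⟩ := exists_point_near p (lt_min hη (by positivity : 0 < R / 3))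
    exact ⟨w, hS w (hw.trans_le (min_le_right _ _)), by
      rw [dist_comm]; exact hw.trans_le (min_le_left _ _)⟩
  have hconn : IsPreconnected (insert p S) :=
    isPreconnected_connectedComponentIn.subset_closure (subset_insert _ _)
      (insert_subset hp subset_closure)
  refine hconn.subset_connectedComponentIn (mem_insert _ _) (insert_subset ?_ ?_)
    (mem_insert_of_mem _ (_root_.mem_connectedComponentIn hzU))
  · exact hU (Metric.mem_ball_self hR)
  · exact connectedComponentIn_subset _ _

/-! ### Boundary functions are minimal on the boundary -/

theorem IsPreconnected.subset_cutOff {h : G.Completion → ℝ} {A : Set G.Completion} {t : ℝ}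
    {x : G.Completion} {S : Set G.Completion} (hS : IsPreconnected S) (hxS : x ∈ S)
    (hSt : ∀ y ∈ S, h y ≠ t) (hx : x ∈ G.cutOff h A t) : S ⊆ G.cutOff h A t := by
  simp only [cutOff, mem_iUnion] at hx
  obtain ⟨p, hp, hx⟩ := hx
  have hsub : S ⊆ connectedComponentIn {y | h y ≠ t} x := hS.subset_connectedComponentIn hxS hSt
  rw [← connectedComponentIn_eq hx] at hsub
  exact hsub.trans fun y hy => mem_iUnion₂.2 ⟨p, hp, hy⟩

theorem IsHarmonic.deriv_cpt {h : G.Completion → ℝ} {e : E} {a b s : ℝ}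
    (hab : ∀ t ∈ Icc 0 (G.len e), h (G.cpt e t) = a + b * t) (hs : s ∈ Ioo 0 (G.len e)) :
    deriv (fun r => h (G.cpt e r)) s = b := by
  have : (fun r => h (G.cpt e r)) =ᶠ[𝓝 s] fun r => a + b * r := by
    filter_upwards [Ioo_mem_nhds hs.1 hs.2] with r hr using hab r (Ioo_subset_Icc_self hr)
  rw [this.deriv_eq]
  simp

/-- Follow the path as long as h > t; it stays in the part cut off around A. A first crossing of the
level t is interior to an edge, since t is no vertex value, and there h decreases in the direction
of the path, which is the outward normal. This contradicts the positive normal derivative. -/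
theorem HasPath.lt_of_posNormalDeriv {h : G.Completion → ℝ} (hh : G.IsHarmonic h)
    {A : Set G.Completion} {p : G.Completion} (hp : p ∈ A) {ε t : ℝ}
    (ht : ∀ v, h (G.vtx v : G.Point) ≠ t)
    (hpos : ∀ e, ∀ s ∈ Ioo 0 (G.len e), G.cpt e s ∈ Metric.thickening ε A → h (G.cpt e s) = t →
      ((∀ᶠ r in 𝓝[<] s, G.cpt e r ∈ G.cutOff h A t) → 0 < deriv (fun r => h (G.cpt e r)) s) ∧
      ((∀ᶠ r in 𝓝[>] s, G.cpt e r ∈ G.cutOff h A t) → 0 < -deriv (fun r => h (G.cpt e r)) s))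
    {z x : G.Point} {L : ℝ} (hpath : G.HasPath z x L) (hz : (z : G.Completion) ∈ G.cutOff h A t)
    (hzt : t < h z) (hL : dist (z : G.Completion) p + L < ε) : t < h x := by
  induction hpath with
  | refl x => exact hzt
  | step e s u y L hs hu hpath ih =>
    have hL0 := hpath.nonneg
    change G.cpt e s ∈ _ at hz
    change t < h (G.cpt e s) at hzt
    change dist (G.cpt e s) p + _ < ε at hL
    obtain ⟨a, b, hab⟩ := hh.affine e
    have hthick : ∀ r ∈ uIcc s u, G.cpt e r ∈ Metric.thickening ε A := by
      intro r hr
      refine Metric.mem_thickening_iff.2 ⟨p, hp, ?_⟩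
      have h1 := dist_cpt_le e (uIcc_subset_Icc hs hu hr) hs
      have h2 := abs_sub_left_of_mem_uIcc hr
      have h3 := dist_triangle (G.cpt e r) (G.cpt e s) p
      rw [abs_sub_comm u s] at h2
      linarith
    have hseg : ∀ r ∈ uIcc s u, t < h (G.cpt e r) := by
      by_contra! hcon
      obtain ⟨r, hr, hrt⟩ := hcon
      have hrI := uIcc_subset_Icc hs hu hr
      rw [hab r hrI] at hrt
      rw [hab s hs] at hzt
      have hb : b ≠ 0 := by rintro rfl; linarith
      obtain ⟨w, hw⟩ : ∃ w, a + b * w = t := ⟨(t - a) / b, by field_simp; ring⟩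
      -- `w` is the point of the segment where the level `t` is reached
      have hwseg : w ∈ uIcc s r := by
        rw [mem_uIcc]
        rcases lt_or_gt_of_ne hb with hb | hb
        · left; constructor <;> nlinarith
        · right; constructor <;> nlinarith
      have hwI := uIcc_subset_Icc hs hrI hwseg
      have hwt : h (G.cpt e w) = t := by rw [hab w hwI, hw]
      have hw0 : w ≠ 0 := by
        rintro rfl; exact ht (G.src e) (by rw [← hwt, cpt, pt_zero])
      have hw1 : w ≠ G.len e := by
        rintro rfl; exact ht (G.tgt e) (by rw [← hwt, cpt, pt_len])
      have hwIoo : w ∈ Ioo 0 (G.len e) :=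
        ⟨lt_of_le_of_ne hwI.1 hw0.symm, lt_of_le_of_ne hwI.2 hw1⟩
      -- As b ≠ 0, the level t is attained on the edge only at w, so the segment before w avoids it
      -- and stays in the component of its starting point.
      have hcut : ∀ q ∈ uIcc s w, q ≠ w → G.cpt e q ∈ G.cutOff h A t := by
        intro q hq hqw
        have hqI := uIcc_subset_Icc hs hwI hq
        refine IsPreconnected.subset_cutOff (isPreconnected_cpt_image e hs hqI)
          (mem_image_of_mem _ left_mem_uIcc) ?_ hz (mem_image_of_mem _ right_mem_uIcc)
        rintro _ ⟨q', hq', rfl⟩ heq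
        rw [hab q' (uIcc_subset_Icc hs hqI hq'), ← hw] at heq
        have : q' = w := mul_left_cancel₀ hb (by linarith)
        subst this
        rw [mem_uIcc] at hq hq'
        rcases hq with hq | hq <;> rcases hq' with hq' | hq'
        · exact hqw (le_antisymm hq.2 hq'.2)
        · exact hqw (by linarith)
        · exact hqw (by linarith)
        · exact hqw (le_antisymm hq'.1 hq.1)
      obtain ⟨hleft, hright⟩ := hpos e w hwIoo
        (hthick w (uIcc_subset_uIcc left_mem_uIcc hr hwseg)) hwt
      rw [IsHarmonic.deriv_cpt hab hwIoo] at hleft hright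
      have hsw : s ≠ w := by rintro rfl; linarith
      -- Both directions of travel are contradictory: h drops from above t to t between s and w,
      -- while the normal derivative condition makes it increase.
      rcases lt_or_gt_of_ne hsw with hsw | hsw
      · have := hleft (by
          filter_upwards [Ioo_mem_nhdsLT hsw] with q hq
          exact hcut q (by rw [uIcc_of_le hsw.le]; exact Ioo_subset_Icc_self hq) hq.2.ne)
        nlinarith
      · have := hright (by
          filter_upwards [Ioo_mem_nhdsGT hsw] with q hq
          exact hcut q (by rw [uIcc_of_ge hsw.le]; exact Ioo_subset_Icc_self hq) hq.1.ne')
        nlinarith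
    refine ih ?_ (hseg u right_mem_uIcc) ?_
    · refine IsPreconnected.subset_cutOff (isPreconnected_cpt_image e hs hu)
          (mem_image_of_mem _ left_mem_uIcc) ?_ hz (mem_image_of_mem _ right_mem_uIcc)
      rintro _ ⟨q, hq, rfl⟩
      exact (hseg q hq).ne'
    · have h1 := dist_cpt_le e hu hs
      have h3 := dist_triangle (G.cpt e u) (G.cpt e s) p
      rw [abs_sub_comm u s] at h1
      change dist (G.cpt e u) p + _ < ε
      linarith

/-- A harmonic function with positive normal derivative on the level sets close to `A` is minimal
on `A`. -/
theorem PosNormalDeriv.exists_forall_le [Countable V] {h : G.Completion → ℝ}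
    (hh : G.IsHarmonic h) {A : Set G.Completion} {C : ℝ} (hC : ∀ x ∈ A, h x = C)
    (hpos : G.PosNormalDeriv h A C) :
    ∃ ε > 0, ∀ p ∈ A, ∀ x : G.Point, dist (x : G.Completion) p < ε → C ≤ h x := by
  obtain ⟨ε, hε, η, hη, hpos⟩ := hpos
  refine ⟨ε, hε, fun p hp x hx => ?_⟩
  by_contra! hlt
  -- There are only countably many vertex values, so a level t between h x and C, within η of C, can
  -- be chosen to be crossed only inside edges.
  have hcount : (range fun v => h (G.vtx v : G.Point)).Countable := countable_range _
  obtain ⟨t, htv, ht⟩ := (hcount.dense_compl ℝ).exists_between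
    (max_lt hlt (by linarith : C - η < C))
  have htx : h x < t := (le_max_left _ _).trans_lt ht.1
  have htη : C - η < t := (le_max_right _ _).trans_lt ht.1
  have hnear : {y | t < h y} ∈ 𝓝 p :=
    (isOpen_lt continuous_const hh.continuous).mem_nhds (by simpa [hC p hp] using ht.2)
  obtain ⟨R, hR, hball⟩ := Metric.mem_nhds_iff.1 hnear
  -- The bound R/3 puts z in the component of p, and the other bound keeps a nearly shortest path
  -- from z to x inside the ε-ball around p.
  obtain ⟨z, hz⟩ := exists_point_near p (lt_min (by positivity : 0 < R / 3)
    (by linarith : 0 < (ε - dist (x : G.Completion) p) / 3))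
  rw [lt_min_iff] at hz
  have hzx : dist z x < dist (x : G.Completion) p + (ε - dist (x : G.Completion) p) / 3 := by
    rw [← UniformSpace.Completion.dist_eq]
    have := dist_triangle_right (z : G.Completion) x p
    linarith
  obtain ⟨L, hL, hL'⟩ := exists_hasPath_lt hzx
  have := hL.lt_of_posNormalDeriv hh hp (fun v hv => htv ⟨v, hv⟩)
    (hpos t ht.2.ne (abs_lt.2 ⟨by linarith, by linarith [ht.2]⟩))
    (mem_iUnion₂.2 ⟨p, hp, mem_connectedComponentIn_of_dist_lt
      (hball.trans fun y hy => ne_of_gt hy) hz.1⟩)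
    (hball (Metric.mem_ball.2 (by linarith))) (by linarith)
  linarith

/-! ### Leaving an edge -/

/-- Each segment that starts in the open edge either stays there or stops at an end of the edge; on
first arrival at an end the path has covered at least the distance from s to that end. -/
theorem HasPath.exit_edge {x y : G.Point} {L : ℝ} (h : G.HasPath x y L) {e : E} {s : ℝ}
    (hs : s ∈ Ioo 0 (G.len e)) (hx : x = G.pt e s) :
    (∃ t ∈ Ioo 0 (G.len e), y = G.pt e t) ∨
    (∃ L', G.HasPath (G.vtx (G.src e)) y L' ∧ s + L' ≤ L) ∨
    (∃ L', G.HasPath (G.vtx (G.tgt e)) y L' ∧ (G.len e - s) + L' ≤ L) := by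
  induction h generalizing s with
  | refl x => exact .inl ⟨s, hs, hx⟩
  | step e' s' t y L hs' ht h ih =>
    have : e' = e ∧ s' = s := by
      rw [pt_of_mem_Ioo hs, pt] at hx
      split_ifs at hx
      · simpa using hx
      · simp [vtx] at hx
      · simp [vtx] at hx
    obtain ⟨rfl, rfl⟩ := this
    rcases ht.1.eq_or_lt with rfl | ht0
    · rw [pt_zero] at h
      exact .inr (.inl ⟨L, h, by rw [sub_zero]; linarith [le_abs_self s']⟩)
    rcases ht.2.eq_or_lt with rfl | ht1
    · rw [pt_len] at h
      exact .inr (.inr ⟨L, h, by linarith [neg_abs_le (s' - G.len e')]⟩)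
    rcases ih ⟨ht0, ht1⟩ rfl with h1 | ⟨L', h1, h2⟩ | ⟨L', h1, h2⟩
    · exact .inl h1
    · exact .inr (.inl ⟨L', h1, by linarith [le_abs_self (s' - t)]⟩)
    · exact .inr (.inr ⟨L', h1, by linarith [neg_abs_le (s' - t)]⟩)

theorem cpt_notMem_boundary {e : E} {t : ℝ} (ht : t ∈ Ioo 0 (G.len e)) :
    G.cpt e t ∉ G.boundary := by
  refine fun h => h ⟨G.pt e t, ?_, rfl⟩
  rw [pt_of_mem_Ioo ht]
  rintro ⟨v, -, hv⟩
  simp [vtx] at hv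

/-- Either p lies on the closed edge, and then it is itself a graph point outside the open edge, or
it has positive distance from the closed edge, which is compact. -/
theorem exists_near_not_on_edge {p : G.Completion} (hp : p ∈ G.boundary) (e : E) {η : ℝ}
    (hη : 0 < η) : ∃ y : G.Point, dist (y : G.Completion) p < η ∧
      ¬ ∃ t ∈ Ioo 0 (G.len e), y = G.pt e t := by
  by_cases hpe : p ∈ G.cpt e '' Icc 0 (G.len e)
  · obtain ⟨u, hu, rfl⟩ := hpe
    refine ⟨G.pt e u, by simpa [cpt] using hη, ?_⟩
    rintro ⟨t, ht, htu⟩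
    refine cpt_notMem_boundary ht ?_
    rwa [cpt, ← htu]
  · have hclosed : IsClosed (G.cpt e '' Icc 0 (G.len e)) :=
      (isCompact_Icc.image_of_continuousOn (continuousOn_cpt e)).isClosed
    obtain ⟨ρ, hρ, hball⟩ := Metric.isOpen_iff.1 hclosed.isOpen_compl p hpe
    obtain ⟨y, hy⟩ := exists_point_near p (lt_min hη hρ)
    rw [lt_min_iff] at hy
    refine ⟨y, hy.1, ?_⟩
    rintro ⟨t, ht, rfl⟩
    exact hball (Metric.mem_ball.2 hy.2) ⟨t, Ioo_subset_Icc_self ht, rfl⟩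

/-- The boundary can only be reached from an edge through one of its ends. -/
theorem exists_end_near {p : G.Completion} (hp : p ∈ G.boundary) {e : E} {s ρ : ℝ}
    (hs : s ∈ Icc 0 (G.len e)) (h : dist (G.cpt e s) p < ρ) :
    dist (G.cpt e 0) p + s < ρ ∨ dist (G.cpt e (G.len e)) p + (G.len e - s) < ρ := by
  rcases hs.1.eq_or_lt with rfl | hs0
  · left; simpa using h
  rcases hs.2.eq_or_lt with rfl | hs1
  · right; simpa using h
  obtain ⟨y, hy, hye⟩ := exists_near_not_on_edge hp e
    (by linarith : 0 < (ρ - dist (G.cpt e s) p) / 3)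
  have hsy : dist (G.pt e s) y < dist (G.cpt e s) p + (ρ - dist (G.cpt e s) p) / 3 := by
    rw [← UniformSpace.Completion.dist_eq]
    have := dist_triangle_right (G.cpt e s) y p
    change dist (G.cpt e s) y < _
    linarith
  obtain ⟨L, hL, hL'⟩ := exists_hasPath_lt hsy
  rcases hL.exit_edge ⟨hs0, hs1⟩ rfl with h1 | ⟨L', h1, h2⟩ | ⟨L', h1, h2⟩
  · exact absurd h1 hye
  · left
    have h3 := dist_le_of_hasPath h1
    rw [← pt_zero, ← UniformSpace.Completion.dist_eq] at h3
    change dist (G.cpt e 0) y ≤ L' at h3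
    have := dist_triangle (G.cpt e 0) y p
    linarith
  · right
    have h3 := dist_le_of_hasPath h1
    rw [← pt_len, ← UniformSpace.Completion.dist_eq] at h3
    change dist (G.cpt e (G.len e)) y ≤ L' at h3
    have := dist_triangle (G.cpt e (G.len e)) y p
    linarith

/-! ### Finitely many edges away from the boundary -/

theorem pt_eq_vtx {e : E} {t : ℝ} (ht : t ∈ Icc 0 (G.len e)) {v : V} (h : G.pt e t = G.vtx v) :
    (t = 0 ∧ G.src e = v) ∨ (t = G.len e ∧ G.tgt e = v) := by
  rcases ht.1.eq_or_lt with rfl | ht0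
  · rw [pt_zero] at h
    exact .inl ⟨rfl, by simpa [vtx] using h⟩
  rcases ht.2.eq_or_lt with rfl | ht1
  · rw [pt_len] at h
    exact .inr ⟨rfl, by simpa [vtx] using h⟩
  · rw [pt_of_mem_Ioo ⟨ht0, ht1⟩] at h
    simp [vtx] at h

theorem pt_eq_inner {e e' : E} {t t' : ℝ} {ht' : t' ∈ Ioo 0 (G.len e')}
    (h : G.pt e t = Point.inner e' t' ht') : e = e' ∧ t = t' := by
  rw [pt] at h
  split_ifs at h
  · simpa using h
  · simp [vtx] at h
  · simp [vtx] at h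

/-- Short paths to a vertex stay in its star. -/
theorem HasPath.mem_star {x : G.Point} {v : V} {L ρ : ℝ}
    (hρ : ∀ e, G.src e = v ∨ G.tgt e = v → ρ ≤ G.len e)
    (h : G.HasPath x (G.vtx v) L) (hL : L < ρ) :
    x = G.vtx v ∨ ∃ e t ht, x = Point.inner e t ht ∧
      ((G.src e = v ∧ t ≤ L) ∨ (G.tgt e = v ∧ G.len e - t ≤ L)) := by
  generalize hy : G.vtx v = y at h
  induction h with
  | refl x => exact .inl rfl
  | step e s t y L hs ht h ih =>
    subst hy
    have hL0 := h.nonneg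
    have key : (G.src e = v ∧ t ≤ L) ∨ (G.tgt e = v ∧ G.len e - t ≤ L) := by
      rcases ih (by linarith [abs_nonneg (s - t)]) rfl with h1 | ⟨e', t', ht', h1, h2⟩
      · rcases pt_eq_vtx ht h1 with ⟨rfl, h2⟩ | ⟨rfl, h2⟩
        · exact .inl ⟨h2, hL0⟩
        · exact .inr ⟨h2, by linarith⟩
      · obtain ⟨rfl, rfl⟩ := pt_eq_inner h1
        exact h2
    rcases key with ⟨h1, h2⟩ | ⟨h1, h2⟩
    · have h3 := hρ e (.inl h1)
      rcases hs.1.eq_or_lt with rfl | hs0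
      · left; rw [pt_zero, h1]
      have hsI : s ∈ Ioo 0 (G.len e) := ⟨hs0, by linarith [le_abs_self (s - t)]⟩
      exact .inr ⟨e, s, hsI, pt_of_mem_Ioo hsI, .inl ⟨h1, by linarith [le_abs_self (s - t)]⟩⟩
    · have h3 := hρ e (.inr h1)
      rcases hs.2.eq_or_lt with rfl | hs1
      · left; rw [pt_len, h1]
      have hsI : s ∈ Ioo 0 (G.len e) := ⟨by linarith [neg_abs_le (s - t)], hs1⟩
      exact .inr ⟨e, s, hsI, pt_of_mem_Ioo hsI, .inr ⟨h1, by linarith [neg_abs_le (s - t)]⟩⟩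

/-- The geodesic distance is only known to be a pseudometric, and the completion identifies points
at distance 0. Local finiteness excludes this at a vertex, because short paths to it stay in its
star; hence boundary vertices do lie in the boundary of the completion. -/
theorem eq_vtx_of_dist_eq_zero {x : G.Point} {v : V} (h : dist x (G.vtx v) = 0) :
    x = G.vtx v := by
  obtain ⟨ρ, hρ, hle⟩ := (G.locallyFinite v).exists_pos_forall_le (f := G.len)
    fun e _ => G.len_pos e
  rcases x with w | ⟨e, t, ht⟩
  · obtain ⟨L, hL, hL'⟩ := exists_hasPath_lt (h.trans_lt hρ)
    rcases HasPath.mem_star hle hL hL' with h1 | ⟨e, t, ht, h1, -⟩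
    · exact h1
    · simp at h1
  · obtain ⟨L, hL, hL'⟩ := exists_hasPath_lt
      (h.trans_lt (lt_min hρ (lt_min ht.1 (sub_pos.2 ht.2))))
    rw [lt_min_iff, lt_min_iff] at hL'
    rcases HasPath.mem_star hle hL hL'.1 with h1 | ⟨e', t', ht', h1, h2⟩
    · exact h1
    · simp only [Point.inner.injEq] at h1
      obtain ⟨rfl, rfl⟩ := h1
      rcases h2 with h2 | h2 <;> linarith

theorem vtx_mem_boundary {v : V} (hv : v ∈ G.bdry) :
    ((G.vtx v : G.Point) : G.Completion) ∈ G.boundary := by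
  rintro ⟨x, hx, hxv⟩
  have : dist x (G.vtx v) = 0 := by
    rw [← UniformSpace.Completion.dist_eq]
    exact (dist_eq_zero.2 hxv)
  exact hx ⟨v, hv, (eq_vtx_of_dist_eq_zero this).symm⟩

/-- Around a vertex, ρ is the least length of an adjacent edge and short paths stay in the star.
Around a point inside an edge, ρ is the distance to the nearer end, and shorter paths do not leave
the edge. -/
theorem exists_finite_edges_near (x : G.Point) :
    ∃ ρ > 0, {e | ∃ s ∈ Icc 0 (G.len e), dist (G.pt e s) x < ρ}.Finite := by
  rcases x with v | ⟨e, t, ht⟩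
  · obtain ⟨ρ, hρ, hle⟩ := (G.locallyFinite v).exists_pos_forall_le (f := G.len)
      fun e _ => G.len_pos e
    refine ⟨ρ, hρ, (G.locallyFinite v).subset ?_⟩
    rintro e ⟨s, hs, hd⟩
    obtain ⟨L, hL, hL'⟩ := exists_hasPath_lt hd
    rcases HasPath.mem_star hle hL hL' with h1 | ⟨e', t', ht', h1, h2⟩
    · rcases pt_eq_vtx hs h1 with h | h
      · exact .inl h.2
      · exact .inr h.2
    · obtain ⟨rfl, rfl⟩ := pt_eq_inner h1
      exact h2.imp And.left And.left
  · refine ⟨min t (G.len e - t), lt_min ht.1 (sub_pos.2 ht.2), (finite_singleton e).subset ?_⟩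
    rintro e' ⟨s, hs, hd⟩
    rw [dist_comm] at hd
    obtain ⟨L, hL, hL'⟩ := exists_hasPath_lt hd
    rw [lt_min_iff] at hL'
    rcases hL.exit_edge ht (pt_of_mem_Ioo ht).symm with ⟨t', ht', h1⟩ | ⟨L', h1, h2⟩ | ⟨L', h1, h2⟩
    · rw [pt_of_mem_Ioo ht'] at h1
      exact (pt_eq_inner h1).1
    · linarith [h1.nonneg]
    · linarith [h1.nonneg]

variable (G) in
/-- The edges that are not contained in the `r`-neighborhood of the boundary. -/
def farEdges (r : ℝ) : Set E :=
  {e | ∃ s ∈ Icc 0 (G.len e), G.cpt e s ∉ Metric.thickening r G.boundary}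

/-- The complement of the neighborhood of the boundary is compact and consists of graph points, each
with a ball that meets finitely many edges. -/
theorem finite_farEdges [CompactSpace G.Completion] {r : ℝ} (hr : 0 < r) :
    (G.farEdges r).Finite := by
  have hK : IsCompact (Metric.thickening r G.boundary)ᶜ :=
    Metric.isOpen_thickening.isClosed_compl.isCompact
  have : {e | ∃ s ∈ Icc 0 (G.len e), G.cpt e s ∈ (Metric.thickening r G.boundary)ᶜ}.Finite := by
    refine hK.induction_on (p := fun S => {e | ∃ s ∈ Icc 0 (G.len e), G.cpt e s ∈ S}.Finite)
      (by simp) (fun S T hST hT => hT.subset fun e ⟨s, hs, h⟩ => ⟨s, hs, hST h⟩)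
      (fun S T hS hT => (hS.union hT).subset ?_) ?_
    · rintro e ⟨s, hs, h | h⟩
      · exact .inl ⟨s, hs, h⟩
      · exact .inr ⟨s, hs, h⟩
    · intro p hp
      have hpb : p ∉ G.boundary := fun h => hp (Metric.self_subset_thickening hr _ h)
      obtain ⟨x, -, rfl⟩ := notMem_compl_iff.1 hpb
      obtain ⟨ρ, hρ, hfin⟩ := exists_finite_edges_near x
      refine ⟨Metric.ball (x : G.Completion) ρ, mem_nhdsWithin_of_mem_nhds
        (Metric.ball_mem_nhds _ hρ), hfin.subset ?_⟩
      rintro e ⟨s, hs, h⟩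
      exact ⟨s, hs, by rwa [← UniformSpace.Completion.dist_eq]⟩
  exact this

/-- The midpoint is closer than r to the boundary, which is reached only through an end, half the
length away. -/
theorem len_lt_of_notMem_farEdges {r : ℝ} {e : E} (he : e ∉ G.farEdges r) :
    G.len e < 2 * r := by
  have hl := G.len_pos e
  have hmid : G.len e / 2 ∈ Icc 0 (G.len e) := ⟨by linarith, by linarith⟩
  have : G.cpt e (G.len e / 2) ∈ Metric.thickening r G.boundary := by
    by_contra h
    exact he ⟨_, hmid, h⟩
  obtain ⟨p, hp, hd⟩ := Metric.mem_thickening_iff.1 this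
  rcases exists_end_near hp hmid hd with h | h
  · linarith [dist_nonneg (x := G.cpt e 0) (y := p)]
  · linarith [dist_nonneg (x := G.cpt e (G.len e)) (y := p)]

end MetricGraph

/-! ### Measurability on the disjoint union of the edges -/

theorem Sigma.measurable_iff {ι β : Type*} [MeasurableSpace β] {g : (Σ _ : ι, ℝ) → β} :
    Measurable g ↔ ∀ i, Measurable fun t => g ⟨i, t⟩ := by
  constructor
  · intro hg i s hs
    exact (MeasurableSpace.measurableSet_iInf.1 (hg hs)) i
  · intro hg s hs
    exact MeasurableSpace.measurableSet_iInf.2 fun i => hg i hs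

theorem Sigma.measurableEmbedding_mk {ι : Type*} (i : ι) :
    MeasurableEmbedding (fun t : ℝ => (⟨i, t⟩ : Σ _ : ι, ℝ)) where
  injective := fun s t h => by simpa using h
  measurable := Sigma.measurable_iff.1 measurable_id i
  measurableSet_image' := by
    intro s hs
    refine MeasurableSpace.measurableSet_iInf.2 fun j => ?_
    change MeasurableSet ((fun t : ℝ => (⟨j, t⟩ : Σ _ : ι, ℝ)) ⁻¹'
      ((fun t : ℝ => (⟨i, t⟩ : Σ _ : ι, ℝ)) '' s))
    by_cases h : i = j
    · subst h
      rwa [preimage_image_eq _ fun s t h => by simpa using h]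
    · convert MeasurableSet.empty
      ext t
      simp [h]

/-- Edge functions are extended by constants beyond the ends, so the two-sided `deriv` is meaningful
only on open edges. -/
theorem ae_restrict_Icc_iff_ae_restrict_Ioo {a b : ℝ} {p : ℝ → Prop} :
    (∀ᵐ t ∂volume.restrict (Icc a b), p t) ↔ ∀ᵐ t ∂volume.restrict (Ioo a b), p t := by
  rw [Measure.restrict_congr_set Ioo_ae_eq_Icc]

namespace MetricGraph

variable {V E : Type*} {G : MetricGraph V E}

/-! ### Integration on the graph -/

theorem countable_edges [Countable V] (G : MetricGraph V E) : Countable E := by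
  have : (⋃ v, {e | G.src e = v ∨ G.tgt e = v}) = univ :=
    eq_univ_of_forall fun e => mem_iUnion.2 ⟨G.src e, .inl rfl⟩
  rw [← countable_univ_iff, ← this]
  exact countable_iUnion fun v => (G.locallyFinite v).countable

theorem ae_edgeMeasure_iff [Countable V] {p : (Σ _ : E, ℝ) → Prop} :
    (∀ᵐ q ∂G.edgeMeasure, p q) ↔ ∀ e, ∀ᵐ t ∂volume.restrict (Ioo 0 (G.len e)), p ⟨e, t⟩ := by
  have := G.countable_edges
  rw [edgeMeasure, Measure.ae_sum_iff]
  refine forall_congr' fun e => ?_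
  rw [(Sigma.measurableEmbedding_mk e).ae_map_iff, ae_restrict_Icc_iff_ae_restrict_Ioo]

theorem ae_edgeMeasure_of_forall [Countable V] {p : (Σ _ : E, ℝ) → Prop}
    (h : ∀ e, ∀ t ∈ Ioo 0 (G.len e), p ⟨e, t⟩) : ∀ᵐ q ∂G.edgeMeasure, p q :=
  ae_edgeMeasure_iff.2 fun e => ae_restrict_of_forall_mem measurableSet_Ioo (h e)

theorem hasSum_integral_edges {g : (Σ _ : E, ℝ) → ℝ} (hg : Integrable g G.edgeMeasure) :
    HasSum (fun e => ∫ t in (0)..(G.len e), g ⟨e, t⟩) (∫ q, g q ∂G.edgeMeasure) := by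
  have h := hasSum_integral_measure hg
  refine h.congr_fun ?_ 
  intro e
  rw [(Sigma.measurableEmbedding_mk e).integral_map, integral_Icc_eq_integral_Ioc,
    intervalIntegral.integral_of_le (G.len_pos e).le]

/-! ### Derivatives on an edge -/

theorem derivWithin_Icc_eq_deriv {g : ℝ → ℝ} {l t : ℝ} (ht : t ∈ Ioo 0 l) :
    derivWithin g (Icc 0 l) t = deriv g t :=
  derivWithin_of_mem_nhds (Icc_mem_nhds ht.1 ht.2)

theorem deriv_derivWithin_Icc {g : ℝ → ℝ} {l t : ℝ} (ht : t ∈ Ioo 0 l) :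
    deriv (derivWithin g (Icc 0 l)) t = deriv (deriv g) t := by
  refine Filter.EventuallyEq.deriv_eq ?_
  filter_upwards [Ioo_mem_nhds ht.1 ht.2] with s hs using derivWithin_Icc_eq_deriv hs

variable (G) in
/-- The energy of `f` on the edge `e`. -/
noncomputable def edgeEnergy (f : G.Point → ℝ) (e : E) : ℝ :=
  ∫ t in (0)..(G.len e), (edgeDeriv (G.comp f) ⟨e, t⟩) ^ 2

variable (G) in
/-- The derivative of `f` at the initial point of `e`. -/
noncomputable def srcDeriv (f : G.Point → ℝ) (e : E) : ℝ :=
  derivWithin (fun t => f (G.pt e t)) (Icc 0 (G.len e)) 0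

variable (G) in
/-- The derivative of `f` at the end point of `e`. -/
noncomputable def tgtDeriv (f : G.Point → ℝ) (e : E) : ℝ :=
  derivWithin (fun t => f (G.pt e t)) (Icc 0 (G.len e)) (G.len e)

theorem edgeEnergy_nonneg (f : G.Point → ℝ) (e : E) : 0 ≤ G.edgeEnergy f e :=
  intervalIntegral.integral_nonneg (G.len_pos e).le fun _ _ => sq_nonneg _

section Affine

variable {f : G.Point → ℝ} {e : E} {a b : ℝ}

theorem srcDeriv_of_affine_near {ρ : ℝ} (hρ : 0 < ρ)
    (h : ∀ t ∈ Icc 0 (G.len e), t < ρ → f (G.pt e t) = a + b * t) :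
    G.srcDeriv f e = b := by
  have hl := G.len_pos e
  have h0 : (0 : ℝ) ∈ Icc 0 (G.len e) := left_mem_Icc.2 hl.le
  have : (fun t => f (G.pt e t)) =ᶠ[𝓝[Icc 0 (G.len e)] 0] fun t => a + b * t := by
    filter_upwards [self_mem_nhdsWithin, mem_nhdsWithin_of_mem_nhds (Iio_mem_nhds hρ)]
      with t ht ht' using h t ht ht'
  rw [srcDeriv, this.derivWithin_eq (h 0 h0 hρ)]
  have hd : HasDerivAt (fun t => a + b * t) b 0 := by
    simpa using ((hasDerivAt_id (0 : ℝ)).const_mul b).const_add a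
  exact hd.hasDerivWithinAt.derivWithin (uniqueDiffOn_Icc hl 0 h0)

theorem tgtDeriv_of_affine_near {ρ : ℝ} (hρ : 0 < ρ)
    (h : ∀ t ∈ Icc 0 (G.len e), G.len e - t < ρ → f (G.pt e t) = a + b * t) :
    G.tgtDeriv f e = b := by
  have hl := G.len_pos e
  have h1 : G.len e ∈ Icc 0 (G.len e) := right_mem_Icc.2 hl.le
  have : (fun t => f (G.pt e t)) =ᶠ[𝓝[Icc 0 (G.len e)] (G.len e)] fun t => a + b * t := by
    filter_upwards [self_mem_nhdsWithin,
      mem_nhdsWithin_of_mem_nhds (Ioi_mem_nhds (by linarith : G.len e - ρ < G.len e))]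
      with t ht ht' using h t ht (by linarith [mem_Ioi.1 ht'])
  rw [tgtDeriv, this.derivWithin_eq (h _ h1 (by linarith))]
  have hd : HasDerivAt (fun t => a + b * t) b (G.len e) := by
    simpa using ((hasDerivAt_id (G.len e)).const_mul b).const_add a
  exact hd.hasDerivWithinAt.derivWithin (uniqueDiffOn_Icc hl _ h1)

theorem edgeDeriv_of_affine (h : ∀ t ∈ Icc 0 (G.len e), f (G.pt e t) = a + b * t) {t : ℝ}
    (ht : t ∈ Ioo 0 (G.len e)) : edgeDeriv (G.comp f) ⟨e, t⟩ = b := by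
  have : (fun t => f (G.pt e t)) =ᶠ[𝓝 t] fun t => a + b * t := by
    filter_upwards [Ioo_mem_nhds ht.1 ht.2] with r hr using h r (Ioo_subset_Icc_self hr)
  change deriv (fun t => f (G.pt e t)) t = b
  rw [this.deriv_eq]
  simp

theorem edgeDeriv_edgeDeriv_of_affine (h : ∀ t ∈ Icc 0 (G.len e), f (G.pt e t) = a + b * t)
    {t : ℝ} (ht : t ∈ Ioo 0 (G.len e)) :
    edgeDeriv (edgeDeriv (G.comp f)) ⟨e, t⟩ = 0 := by
  have : (fun t => edgeDeriv (G.comp f) ⟨e, t⟩) =ᶠ[𝓝 t] fun _ => b := by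
    filter_upwards [Ioo_mem_nhds ht.1 ht.2] with r hr using edgeDeriv_of_affine h hr
  change deriv (fun t => edgeDeriv (G.comp f) ⟨e, t⟩) t = 0
  rw [this.deriv_eq]
  simp

theorem intervalIntegral_congr_Ioo {g h : ℝ → ℝ} {l : ℝ} (hl : 0 ≤ l)
    (hgh : ∀ t ∈ Ioo 0 l, g t = h t) : ∫ t in (0)..l, g t = ∫ t in (0)..l, h t := by
  rw [intervalIntegral.integral_of_le hl, intervalIntegral.integral_of_le hl,
    integral_Ioc_eq_integral_Ioo, integral_Ioc_eq_integral_Ioo]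
  exact setIntegral_congr_fun measurableSet_Ioo hgh

theorem edgeEnergy_of_affine (h : ∀ t ∈ Icc 0 (G.len e), f (G.pt e t) = a + b * t) :
    G.edgeEnergy f e = b ^ 2 * G.len e := by
  rw [edgeEnergy, intervalIntegral_congr_Ioo (G.len_pos e).le
    (fun t ht => by rw [edgeDeriv_of_affine h ht] : ∀ t ∈ Ioo 0 (G.len e), _ = b ^ 2)]
  simp [mul_comm]

end Affine

/-! ### Green's formula -/

/-- The derivative is absolutely continuous, hence bounded, so f is Lipschitz on the edge. -/
theorem MemDMax.absolutelyContinuousOnInterval {f : G.Point → ℝ} (hf : G.MemDMax f) (e : E) :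
    AbsolutelyContinuousOnInterval (fun t => f (G.pt e t)) 0 (G.len e) := by
  obtain ⟨K, hK⟩ := (hf.absCont e).exists_bound
  have hl := (G.len_pos e).le
  refine LipschitzOnWith.absolutelyContinuousOnInterval (K := K.toNNReal) ?_
  rw [uIcc_of_le hl] at *
  refine (convex_Icc _ _).lipschitzOnWith_of_nnnorm_derivWithin_le (hf.differentiableOn e)
    fun x hx => ?_
  rw [← NNReal.coe_le_coe, coe_nnnorm]
  exact (hK x hx).trans (Real.le_coe_toNNReal K)

theorem MemDMax.integral_edge {f : G.Point → ℝ} (hf : G.MemDMax f) (e : E) :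
    ∫ t in (0)..(G.len e), f (G.pt e t) * -edgeDeriv (edgeDeriv (G.comp f)) ⟨e, t⟩ =
      G.edgeEnergy f e + f (G.vtx (G.src e)) * G.srcDeriv f e -
        f (G.vtx (G.tgt e)) * G.tgtDeriv f e := by
  have hl := (G.len_pos e).le
  have h := (hf.absolutelyContinuousOnInterval e).integral_mul_deriv_eq_deriv_mul (hf.absCont e)
  have h1 : ∫ t in (0)..(G.len e), deriv (fun t => f (G.pt e t)) t *
      derivWithin (fun t => f (G.pt e t)) (Icc 0 (G.len e)) t = G.edgeEnergy f e :=
    intervalIntegral_congr_Ioo hl fun t ht => by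
      rw [derivWithin_Icc_eq_deriv ht, sq]; rfl
  have h2 : ∫ t in (0)..(G.len e), f (G.pt e t) * -edgeDeriv (edgeDeriv (G.comp f)) ⟨e, t⟩ =
      ∫ t in (0)..(G.len e), -(f (G.pt e t) *
        deriv (derivWithin (fun t => f (G.pt e t)) (Icc 0 (G.len e))) t) :=
    intervalIntegral_congr_Ioo hl fun t ht => by
      rw [deriv_derivWithin_Icc ht, mul_neg]; rfl
  rw [h2, intervalIntegral.integral_neg, h, h1, pt_zero, pt_len]
  simp only [srcDeriv, tgtDeriv]
  ring

theorem MemDMax.hasSum_inner {f : G.Point → ℝ} (hf : G.MemDMax f) :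
    HasSum (fun e => G.edgeEnergy f e + f (G.vtx (G.src e)) * G.srcDeriv f e -
      f (G.vtx (G.tgt e)) * G.tgtDeriv f e) (inner ℝ (G.negD2 hf) (G.toL2 hf)) := by
  have hae : (fun q => inner ℝ (G.negD2 hf q) (G.toL2 hf q)) =ᵐ[G.edgeMeasure]
      fun q => G.comp f q * -edgeDeriv (edgeDeriv (G.comp f)) q := by
    filter_upwards [hf.memLp.coeFn_toLp, hf.memLp_deriv2.coeFn_toLp,
      Lp.coeFn_neg (hf.memLp_deriv2.toLp _)] with q h1 h2 h3
    rw [negD2, toL2, h1, h3, Pi.neg_apply, h2]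
    simp
  rw [L2.inner_def, integral_congr_ae hae]
  have hint := (L2.integrable_inner (𝕜 := ℝ) (G.negD2 hf) (G.toL2 hf)).congr hae
  convert hasSum_integral_edges hint using 2 with e
  exact (hf.integral_edge e).symm

/-- Where f is affine, f'' = 0 and energy and end terms cancel. The sum becomes finite, so it can be
regrouped by vertices. -/
theorem MemDMax.inner_eq_sum {f : G.Point → ℝ} (hf : G.MemDMax f) (T : Finset E)
    (hT : ∀ e ∉ T, ∃ a b, ∀ t ∈ Icc 0 (G.len e), f (G.pt e t) = a + b * t) :
    inner ℝ (G.negD2 hf) (G.toL2 hf) =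
      ∑ e ∈ T, (G.edgeEnergy f e + f (G.vtx (G.src e)) * G.srcDeriv f e -
        f (G.vtx (G.tgt e)) * G.tgtDeriv f e) := by
  refine hf.hasSum_inner.unique (hasSum_sum_of_ne_finset_zero fun e he => ?_)
  obtain ⟨a, b, hab⟩ := hT e he
  have hl := G.len_pos e
  rw [edgeEnergy_of_affine hab, srcDeriv_of_affine_near one_pos fun t ht _ => hab t ht,
    tgtDeriv_of_affine_near one_pos fun t ht _ => hab t ht, ← pt_zero, ← pt_len,
    hab 0 (left_mem_Icc.2 hl.le), hab _ (right_mem_Icc.2 hl.le)]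
  ring

/-- Group the edge ends by vertex: where ψ is nonzero, T contains the whole star, and the group is ψ
times the Kirchhoff sum. -/
theorem sum_mul_vertexFlux_eq_zero {f : G.Point → ℝ}
    (hf : ∀ v, v ∉ G.bdry → G.vertexFlux f v = 0) (ψ : V → ℝ)
    (hψ : ∀ v ∈ G.bdry, ψ v = 0) (T : Finset E)
    (hT : ∀ e ∉ T, ψ (G.src e) = 0 ∧ ψ (G.tgt e) = 0) :
    ∑ e ∈ T, (ψ (G.src e) * G.srcDeriv f e - ψ (G.tgt e) * G.tgtDeriv f e) = 0 := by
  classical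
  have key : ∀ (g : E → V) (d : E → ℝ), (∀ e ∉ T, ψ (g e) = 0) → ∀ v,
      ψ v * (∑ᶠ (e : E) (_ : g e = v), d e) = ∑ e ∈ T with g e = v, ψ (g e) * d e := by
    intro g d hg v
    by_cases hv : ψ v = 0
    · rw [hv, zero_mul, Finset.sum_eq_zero]
      intro e he
      rw [(Finset.mem_filter.1 he).2, hv, zero_mul]
    · have hset : ∀ e, (g e = v) = (e ∈ (↑(T.filter fun e => g e = v) : Set E)) := by
        intro e
        simp only [Finset.coe_filter, mem_ofPred_eq, eq_iff_iff, iff_and_self]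
        intro h
        by_contra he
        exact hv (h ▸ hg e he)
      have : (∑ᶠ (e : E) (_ : g e = v), d e) =
          ∑ᶠ (e : E) (_ : e ∈ (↑(T.filter fun e => g e = v) : Set E)), d e :=
        finsum_congr fun e => by rw [← hset]
      rw [this, finsum_mem_coe_finset, Finset.mul_sum]
      exact Finset.sum_congr rfl fun e he => by rw [(Finset.mem_filter.1 he).2]
  set s := T.image G.src ∪ T.image G.tgt with hs
  have h1 := Finset.sum_fiberwise_of_maps_to (s := T) (t := s) (g := G.src)
    (fun e he => Finset.mem_union_left _ (Finset.mem_image_of_mem _ he))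
    fun e => ψ (G.src e) * G.srcDeriv f e
  have h2 := Finset.sum_fiberwise_of_maps_to (s := T) (t := s) (g := G.tgt)
    (fun e he => Finset.mem_union_right _ (Finset.mem_image_of_mem _ he))
    fun e => ψ (G.tgt e) * G.tgtDeriv f e
  rw [Finset.sum_sub_distrib, ← h1, ← h2, ← Finset.sum_sub_distrib]
  refine Finset.sum_eq_zero fun v _ => ?_
  rw [← key G.src _ (fun e he => (hT e he).1), ← key G.tgt _ (fun e he => (hT e he).2), ← mul_sub]
  by_cases hv : v ∈ G.bdry
  · rw [hψ v hv, zero_mul]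
  · exact mul_eq_zero_of_right _ (hf v hv)

variable (G) in
/-- The contribution of the edge `e` to Green's formula, when the test function `ψ` is subtracted
from the boundary values of `f`. -/
noncomputable def greenTerm (f : G.Point → ℝ) (ψ : V → ℝ) (e : E) : ℝ :=
  G.edgeEnergy f e + (f (G.vtx (G.src e)) - ψ (G.src e)) * G.srcDeriv f e -
    (f (G.vtx (G.tgt e)) - ψ (G.tgt e)) * G.tgtDeriv f e

theorem MemDMax.inner_eq_sum_greenTerm {f : G.Point → ℝ} (hf : G.MemDMax f) (ψ : V → ℝ)
    (hψ : ∀ v ∈ G.bdry, ψ v = 0) (T : Finset E)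
    (hTψ : ∀ e ∉ T, ψ (G.src e) = 0 ∧ ψ (G.tgt e) = 0)
    (hT : ∀ e ∉ T, ∃ a b, ∀ t ∈ Icc 0 (G.len e), f (G.pt e t) = a + b * t) :
    inner ℝ (G.negD2 hf) (G.toL2 hf) = ∑ e ∈ T, G.greenTerm f ψ e := by
  rw [hf.inner_eq_sum T hT, ← sub_zero (Finset.sum _ _),
    ← sum_mul_vertexFlux_eq_zero hf.kirchhoff ψ hψ T hTψ, ← Finset.sum_sub_distrib]
  refine Finset.sum_congr rfl fun e _ => ?_
  rw [greenTerm]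
  ring

theorem greenTerm_of_affine {f : G.Point → ℝ} (ψ : V → ℝ) {e : E} {a b : ℝ}
    (hab : ∀ t ∈ Icc 0 (G.len e), f (G.pt e t) = a + b * t) :
    G.greenTerm f ψ e = b * (ψ (G.tgt e) - ψ (G.src e)) := by
  have hl := G.len_pos e
  rw [greenTerm, edgeEnergy_of_affine hab, srcDeriv_of_affine_near one_pos fun t ht _ => hab t ht,
    tgtDeriv_of_affine_near one_pos fun t ht _ => hab t ht, ← pt_zero, ← pt_len,
    hab 0 (left_mem_Icc.2 hl.le), hab _ (right_mem_Icc.2 hl.le)]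
  ring

end MetricGraph

/-! ### A monotone truncation -/

/-- A monotone function on `[C, ∞)` that vanishes up to `C + σ`, is the identity beyond `C + σ₀`,
and jumps by `C` at `C + σ₀`. -/
noncomputable def truncation (C σ σ₀ x : ℝ) : ℝ :=
  (if C + σ < x then x - C else 0) + (if C + σ₀ < x then C else 0)

section Truncation

variable {C σ σ₀ x y : ℝ}

theorem truncation_of_le (hσ₀ : σ ≤ σ₀) (hx : x ≤ C + σ) : truncation C σ σ₀ x = 0 := by
  rw [truncation, if_neg (by linarith), if_neg (by linarith), add_zero]

theorem truncation_of_lt (hσ₀ : σ ≤ σ₀) (hx : C + σ₀ < x) : truncation C σ σ₀ x = x := by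
  rw [truncation, if_pos (by linarith), if_pos hx, sub_add_cancel]

theorem truncation_mono (hC : 0 ≤ C) (hx : C ≤ x) (hxy : x ≤ y) :
    truncation C σ σ₀ x ≤ truncation C σ σ₀ y := by
  unfold truncation
  split_ifs <;> linarith

/-- The truncation lags behind the identity only up to C + σ, and the jump there makes up for the
loss. This turns Green terms into upper bounds of energies. -/
theorem sub_le_truncation_sub (hC : 0 ≤ C) (hx : C ≤ x) (hxy : x ≤ y) (hy : C + σ < y) :
    y - x ≤ truncation C σ σ₀ y - truncation C σ σ₀ x := by
  unfold truncation
  split_ifs <;> linarith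

theorem sub_add_le_truncation_sub (hσ₀ : σ ≤ σ₀) (hx : C ≤ x) (hx' : x ≤ C + σ₀)
    (hy : C + σ₀ < y) : y - x + C ≤ truncation C σ σ₀ y - truncation C σ σ₀ x := by
  unfold truncation
  split_ifs <;> linarith

end Truncation

/-! ### The test function and the sign of the Green terms -/

namespace MetricGraph

variable {V E : Type*} {G : MetricGraph V E}

variable (G) in
/-- Close to `F₀` the function `f` vanishes, and close to each point of `F n` it is a multiple of
`k n`, which is minimal on `F n`. -/
structure IsLocallyMultiple {N : ℕ} (δ ε : ℝ) (F₀ : Set G.Completion)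
    (F : Fin N → Set G.Completion) (k : Fin N → G.Completion → ℝ) (C : Fin N → ℝ)
    (f : G.Point → ℝ) : Prop where
  partition : G.IsInitialPartition F₀ F δ
  robin : ∀ n, G.IsRobinFunction (k n) (F n) (C n)
  pos : 0 < ε
  le : ε ≤ δ
  zero : ∀ p ∈ F₀, ∀ x : G.Point, dist (x : G.Completion) p < ε → f x = 0
  multiple : ∀ n, ∀ p ∈ F n, ∃ c : ℝ, ∀ x : G.Point, dist (x : G.Completion) p < ε →
    f x = c * k n x
  minimal : ∀ n, ∀ p ∈ F n, ∀ x : G.Point, dist (x : G.Completion) p < ε → C n ≤ k n x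

open Classical in
/-- The weight of the vertex `v` in the test function. -/
noncomputable def cutWeight {N : ℕ} (F : Fin N → Set G.Completion) (k : Fin N → G.Completion → ℝ)
    (C : Fin N → ℝ) (r σ σ₀ : ℝ) (v : V) : ℝ :=
  if h : ∃ n, ((G.vtx v : G.Point) : G.Completion) ∈ Metric.thickening r (F n) then
    truncation (C h.choose) σ σ₀ (k h.choose (G.vtx v : G.Point)) /
      k h.choose (G.vtx v : G.Point)
  else 1

/-- The test function: it agrees with `f` away from the boundary and is cut off on the part where
`k n` is close to its boundary value. -/
noncomputable def testFun {N : ℕ} (F : Fin N → Set G.Completion) (k : Fin N → G.Completion → ℝ)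
    (C : Fin N → ℝ) (r : ℝ) (f : G.Point → ℝ) (σ σ₀ : ℝ) (v : V) : ℝ :=
  f (G.vtx v) * cutWeight F k C r σ σ₀ v

theorem cpt_zero (e : E) : G.cpt e 0 = ((G.vtx (G.src e) : G.Point) : G.Completion) := by
  rw [cpt, pt_zero]

theorem cpt_len (e : E) : G.cpt e (G.len e) = ((G.vtx (G.tgt e) : G.Point) : G.Completion) := by
  rw [cpt, pt_len]

section Partition

variable {N : ℕ} {δ : ℝ} {F₀ : Set G.Completion} {F : Fin N → Set G.Completion}

theorem IsInitialPartition.eq_of_mem_thickening (hF : G.IsInitialPartition F₀ F δ)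
    {x : G.Completion} {r r' : ℝ} (hr : r ≤ δ) (hr' : r' ≤ δ) {m n : Fin N}
    (hm : x ∈ Metric.thickening r (F m)) (hn : x ∈ Metric.thickening r' (F n)) : m = n := by
  by_contra hne
  exact disjoint_left.1 (hF.disjoint m n hne) (Metric.thickening_mono hr _ hm)
    (Metric.thickening_mono hr' _ hn)

theorem IsInitialPartition.notMem_thickening_zero (hF : G.IsInitialPartition F₀ F δ)
    {x : G.Completion} {r r' : ℝ} (hr : r ≤ δ) (hr' : r' ≤ δ) {n : Fin N}
    (hn : x ∈ Metric.thickening r (F n)) : x ∉ Metric.thickening r' F₀ := fun h =>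
  disjoint_left.1 (hF.disjoint_zero n) (Metric.thickening_mono hr' _ h)
    (Metric.thickening_mono hr _ hn)

theorem IsInitialPartition.subset_boundary (hF : G.IsInitialPartition F₀ F δ) (n : Fin N) :
    F n ⊆ G.boundary := (hF.clopen n).1

theorem IsInitialPartition.mem_thickening_cases (hF : G.IsInitialPartition F₀ F δ)
    {x : G.Completion} {r : ℝ} (hx : x ∈ Metric.thickening r G.boundary) :
    x ∈ Metric.thickening r F₀ ∨ ∃ n, x ∈ Metric.thickening r (F n) := by
  obtain ⟨p, hp, hd⟩ := Metric.mem_thickening_iff.1 hx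
  rw [← hF.cover] at hp
  rcases hp with hp | hp
  · exact .inl (Metric.mem_thickening_iff.2 ⟨p, hp, hd⟩)
  · obtain ⟨n, hn⟩ := mem_iUnion.1 hp
    exact .inr ⟨n, Metric.mem_thickening_iff.2 ⟨p, hn, hd⟩⟩

/-- The δ-neighborhoods of the pieces are disjoint, so a point near F n can be close to the boundary
only through F n. -/
theorem IsInitialPartition.mem_thickening_of_boundary (hF : G.IsInitialPartition F₀ F δ)
    {x : G.Completion} {r r' : ℝ} (hr : r ≤ δ) (hr' : r' ≤ δ) {n : Fin N}
    (hn : x ∈ Metric.thickening r (F n)) (hx : x ∈ Metric.thickening r' G.boundary) :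
    x ∈ Metric.thickening r' (F n) := by
  rcases hF.mem_thickening_cases hx with h | ⟨m, h⟩
  · exact absurd h (hF.notMem_thickening_zero hr hr' hn)
  · rwa [hF.eq_of_mem_thickening hr hr' hn h]

end Partition

theorem IsRobinFunction.exists_lt_of_mem_thickening [CompactSpace G.Completion]
    {h : G.Completion → ℝ} {A : Set G.Completion} {C : ℝ} (hh : G.IsRobinFunction h A C) {σ : ℝ}
    (hσ : 0 < σ) : ∃ r > 0, ∀ x ∈ Metric.thickening r A, h x < C + σ := by
  obtain ⟨r, hr, hd⟩ := Metric.uniformContinuous_iff.1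
    (CompactSpace.uniformContinuous_of_continuous hh.harmonic.continuous) σ hσ
  refine ⟨r, hr, fun x hx => ?_⟩
  obtain ⟨p, hp, hxp⟩ := Metric.mem_thickening_iff.1 hx
  have := hd hxp
  rw [Real.dist_eq, hh.eq_on p hp] at this
  linarith [le_abs_self (h x - C)]

theorem exists_radius [CompactSpace G.Completion] {N : ℕ} {F : Fin N → Set G.Completion}
    {k : Fin N → G.Completion → ℝ} {C : Fin N → ℝ}
    (hk : ∀ n, G.IsRobinFunction (k n) (F n) (C n)) {σ : ℝ} (hσ : 0 < σ) :
    ∃ r > 0, ∀ n, ∀ x ∈ Metric.thickening r (F n), k n x < C n + σ := by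
  choose r hr hlt using fun n => (hk n).exists_lt_of_mem_thickening hσ
  obtain ⟨ρ, hρ, hle⟩ := (finite_univ (α := Fin N)).exists_pos_forall_le (f := r)
    fun n _ => hr n
  exact ⟨ρ, hρ, fun n x hx => hlt n x (Metric.thickening_mono (hle n (mem_univ _)) _ hx)⟩

theorem exists_separation {N : ℕ} (k : Fin N → G.Completion → ℝ) (C : Fin N → ℝ)
    {W : Set V} (hW : W.Finite) :
    ∃ σ > 0, ∀ v ∈ W, ∀ n, C n < k n (G.vtx v : G.Point) → C n + σ < k n (G.vtx v : G.Point) := by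
  have hfin : {q : V × Fin N | q.1 ∈ W ∧ C q.2 < k q.2 (G.vtx q.1 : G.Point)}.Finite :=
    (hW.prod finite_univ).subset fun q hq => ⟨hq.1, mem_univ _⟩
  obtain ⟨ρ, hρ, hle⟩ := hfin.exists_pos_forall_le
    (f := fun q => k q.2 (G.vtx q.1 : G.Point) - C q.2) fun q hq => sub_pos.2 hq.2
  -- Half of the smallest gap, to make the inequality strict.
  refine ⟨ρ / 2, half_pos hρ, fun v hv n hn => ?_⟩
  have := hle (v, n) ⟨hv, hn⟩
  simp only at this
  linarith

namespace IsLocallyMultiple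

variable {N : ℕ} {δ ε : ℝ} {F₀ : Set G.Completion}
    {F : Fin N → Set G.Completion} {k : Fin N → G.Completion → ℝ} {C : Fin N → ℝ}
    {f : G.Point → ℝ}

theorem third_le (h : G.IsLocallyMultiple δ ε F₀ F k C f) : ε / 3 ≤ δ := by
  linarith [h.pos, h.le]

theorem cutWeight_eq (h : G.IsLocallyMultiple δ ε F₀ F k C f) (σ σ₀ : ℝ) {v : V} {n : Fin N}
    (hv : ((G.vtx v : G.Point) : G.Completion) ∈ Metric.thickening (ε / 3) (F n)) :
    cutWeight F k C (ε / 3) σ σ₀ v =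
      truncation (C n) σ σ₀ (k n (G.vtx v : G.Point)) / k n (G.vtx v : G.Point) := by
  have hex : ∃ n, ((G.vtx v : G.Point) : G.Completion) ∈ Metric.thickening (ε / 3) (F n) := ⟨n, hv⟩
  have : hex.choose = n :=
    h.partition.eq_of_mem_thickening h.third_le h.third_le hex.choose_spec hv
  rw [cutWeight, dif_pos hex, this]

theorem minimal_of_mem_thickening (h : G.IsLocallyMultiple δ ε F₀ F k C f) {x : G.Point}
    {n : Fin N} (hx : (x : G.Completion) ∈ Metric.thickening (ε / 3) (F n)) : C n ≤ k n x := by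
  obtain ⟨p, hp, hd⟩ := Metric.mem_thickening_iff.1 hx
  exact h.minimal n p hp x (by linarith [h.pos])

/-- On an edge close to the boundary, `f` vanishes or is a multiple of some `k n`. -/
theorem near_edge (h : G.IsLocallyMultiple δ ε F₀ F k C f) {e : E}
    (he : e ∉ G.farEdges (ε / 3)) :
    (∀ t ∈ Icc 0 (G.len e), f (G.pt e t) = 0) ∨
    ∃ n, ∃ c : ℝ, (∀ t ∈ Icc 0 (G.len e), f (G.pt e t) = c * k n (G.cpt e t)) ∧
      G.cpt e 0 ∈ Metric.thickening (ε / 3) (F n) ∧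
      G.cpt e (G.len e) ∈ Metric.thickening (ε / 3) (F n) := by
  have hε := h.pos
  have hl := G.len_pos e
  have hl' := len_lt_of_notMem_farEdges he
  have h0 : (0 : ℝ) ∈ Icc 0 (G.len e) := left_mem_Icc.2 hl.le
  have h1 : G.len e ∈ Icc 0 (G.len e) := right_mem_Icc.2 hl.le
  have hmem : ∀ t ∈ Icc 0 (G.len e), G.cpt e t ∈ Metric.thickening (ε / 3) G.boundary := by
    intro t ht
    by_contra hcon
    exact he ⟨t, ht, hcon⟩
  -- Distance below ε/3 at one end plus length below 2ε/3: the whole edge lies in one ε-ball, so a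
  -- single constant c serves for it.
  have hdist : ∀ p, dist (G.cpt e 0) p < ε / 3 → ∀ t ∈ Icc 0 (G.len e),
      dist (G.cpt e t) p < ε := by
    intro p hp t ht
    have h2 := dist_cpt_le e ht h0
    rw [sub_zero, abs_of_nonneg ht.1] at h2
    have := dist_triangle (G.cpt e t) (G.cpt e 0) p
    linarith [ht.2]
  rcases h.partition.mem_thickening_cases (hmem 0 h0) with h2 | ⟨n, h2⟩
  · left
    obtain ⟨p, hp, hd⟩ := Metric.mem_thickening_iff.1 h2
    exact fun t ht => h.zero p hp _ (hdist p hd t ht)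
  · right
    obtain ⟨p, hp, hd⟩ := Metric.mem_thickening_iff.1 h2
    obtain ⟨c, hc⟩ := h.multiple n p hp
    refine ⟨n, c, fun t ht => hc _ (hdist p hd t ht), h2, ?_⟩
    exact h.partition.mem_thickening_of_boundary h.le h.third_le
      (Metric.mem_thickening_iff.2 ⟨p, hp, hdist p hd _ h1⟩) (hmem _ h1)

theorem affine_of_notMem_farEdges (h : G.IsLocallyMultiple δ ε F₀ F k C f) {e : E}
    (he : e ∉ G.farEdges (ε / 3)) :
    ∃ a b, ∀ t ∈ Icc 0 (G.len e), f (G.pt e t) = a + b * t := by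
  rcases h.near_edge he with h1 | ⟨n, c, h1, -, -⟩
  · exact ⟨0, 0, fun t ht => by rw [h1 t ht]; ring⟩
  · obtain ⟨a, b, hab⟩ := (h.robin n).harmonic.affine e
    exact ⟨c * a, c * b, fun t ht => by rw [h1 t ht, hab t ht]; ring⟩

theorem testFun_eq (h : G.IsLocallyMultiple δ ε F₀ F k C f) (σ σ₀ : ℝ) {v : V} {n : Fin N}
    {c : ℝ} (hv : ((G.vtx v : G.Point) : G.Completion) ∈ Metric.thickening (ε / 3) (F n))
    (hc : f (G.vtx v) = c * k n (G.vtx v : G.Point)) :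
    testFun F k C (ε / 3) f σ σ₀ v = c * truncation (C n) σ σ₀ (k n (G.vtx v : G.Point)) := by
  have hpos : k n (G.vtx v : G.Point) ≠ 0 :=
    ((h.robin n).pos.trans_le (h.minimal_of_mem_thickening hv)).ne'
  rw [testFun, h.cutWeight_eq σ σ₀ hv, hc]
  field_simp

/-- The terms of Green's formula on the edges close to the boundary. -/
theorem greenTerm_near (h : G.IsLocallyMultiple δ ε F₀ F k C f) (σ σ₀ : ℝ) {e : E} {n : Fin N}
    {c a b : ℝ} (hc : ∀ t ∈ Icc 0 (G.len e), f (G.pt e t) = c * k n (G.cpt e t))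
    (hab : ∀ t ∈ Icc 0 (G.len e), k n (G.cpt e t) = a + b * t)
    (h0 : G.cpt e 0 ∈ Metric.thickening (ε / 3) (F n))
    (h1 : G.cpt e (G.len e) ∈ Metric.thickening (ε / 3) (F n)) :
    G.greenTerm f (testFun F k C (ε / 3) f σ σ₀) e =
      c ^ 2 * (b * (truncation (C n) σ σ₀ (k n (G.cpt e (G.len e))) -
        truncation (C n) σ σ₀ (k n (G.cpt e 0)))) ∧
    G.edgeEnergy f e = c ^ 2 * (b * (k n (G.cpt e (G.len e)) - k n (G.cpt e 0))) := by
  have hl := G.len_pos e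
  have hl0 : (0 : ℝ) ∈ Icc 0 (G.len e) := left_mem_Icc.2 hl.le
  have hl1 : G.len e ∈ Icc 0 (G.len e) := right_mem_Icc.2 hl.le
  have haff : ∀ t ∈ Icc 0 (G.len e), f (G.pt e t) = c * a + c * b * t := fun t ht => by
    rw [hc t ht, hab t ht]; ring
  have e0 := hc 0 hl0
  have e1 := hc _ hl1
  rw [pt_zero, cpt_zero] at e0
  rw [pt_len, cpt_len] at e1
  constructor
  · rw [greenTerm_of_affine _ haff, h.testFun_eq σ σ₀ (by rwa [← cpt_zero]) e0,
      h.testFun_eq σ σ₀ (by rwa [← cpt_len]) e1, cpt_zero, cpt_len]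
    ring
  · rw [edgeEnergy_of_affine haff, hab _ hl0, hab _ hl1]
    ring

/-- At an end near F n either k n exceeds C n + σ₀ and the test function equals f, or k n takes its
minimum C n there and the test function vanishes. In the second case f = c·C n with slope c·b, and b
≥ 0. Away from all F n the weight is 1 and the term is zero. The second claim records the exact
value when f = k n, for use as a surplus. -/
theorem src_term_nonneg (h : G.IsLocallyMultiple δ ε F₀ F k C f) {σ σ₀ : ℝ} (hσ : 0 < σ)
    (hσ₀ : σ ≤ σ₀) {e : E} (hsep : ∀ n, C n < k n (G.vtx (G.src e) : G.Point) →
      C n + σ₀ < k n (G.vtx (G.src e) : G.Point)) :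
    0 ≤ (f (G.vtx (G.src e)) - testFun F k C (ε / 3) f σ σ₀ (G.src e)) * G.srcDeriv f e ∧
    ∀ n a b, (∀ t ∈ Icc 0 (G.len e), k n (G.cpt e t) = a + b * t) →
      (∀ p ∈ F n, ∀ x : G.Point, dist (x : G.Completion) p < ε → f x = k n x) →
      G.cpt e 0 ∈ Metric.thickening (ε / 3) (F n) → k n (G.cpt e 0) = C n →
      0 ≤ b ∧
      C n * b = (f (G.vtx (G.src e)) - testFun F k C (ε / 3) f σ σ₀ (G.src e)) *
        G.srcDeriv f e := by
  have hε := h.pos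
  have hl := G.len_pos e
  have hl0 : (0 : ℝ) ∈ Icc 0 (G.len e) := left_mem_Icc.2 hl.le
  have main : ∀ n p c a b, p ∈ F n → dist (G.cpt e 0) p < ε / 3 →
      (∀ x : G.Point, dist (x : G.Completion) p < ε → f x = c * k n x) →
      (∀ t ∈ Icc 0 (G.len e), k n (G.cpt e t) = a + b * t) → k n (G.cpt e 0) = C n →
      0 ≤ b ∧ c ^ 2 * (C n * b) =
        (f (G.vtx (G.src e)) - testFun F k C (ε / 3) f σ σ₀ (G.src e)) * G.srcDeriv f e := by
    intro n p c a b hp hd hc hab hkC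
    have hdist : ∀ t ∈ Icc 0 (G.len e), t < ε / 3 → dist (G.cpt e t) p < ε := by
      intro t ht ht'
      have h2 := dist_cpt_le e ht hl0
      rw [sub_zero, abs_of_nonneg ht.1] at h2
      have := dist_triangle (G.cpt e t) (G.cpt e 0) p
      linarith [ht.2]
    have ha : a = C n := by rw [← hkC, hab 0 hl0]; ring
    have hd1 : G.srcDeriv f e = c * b :=
      srcDeriv_of_affine_near (a := c * a) (by positivity : 0 < ε / 3) fun t ht ht' => by
        rw [hc _ (hdist t ht ht')]
        change c * k n (G.cpt e t) = _
        rw [hab t ht]; ring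
    have hfv : f (G.vtx (G.src e)) = c * C n := by
      rw [← pt_zero, hc _ (hdist 0 hl0 (by positivity))]
      change c * k n (G.cpt e 0) = _
      rw [hkC]
    rw [cpt_zero] at hd hkC
    have htest := h.testFun_eq σ σ₀ (Metric.mem_thickening_iff.2 ⟨p, hp, hd⟩)
      (by rw [hkC, hfv] : f (G.vtx (G.src e)) = c * k n (G.vtx (G.src e) : G.Point))
    rw [hkC, truncation_of_le hσ₀ (by linarith), mul_zero] at htest
    constructor
    -- A second point of the edge, close enough for the minimality of C n to apply: C n ≤ C n + b·t
    -- gives b ≥ 0.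
    · set t := min (G.len e) (ε / 6)
      have ht0 : 0 < t := lt_min hl (by positivity)
      have htI : t ∈ Icc 0 (G.len e) := ⟨ht0.le, min_le_left _ _⟩
      have := h.minimal n p hp (G.pt e t) (hdist t htI (by
        have : t ≤ ε / 6 := min_le_right _ _
        linarith))
      change C n ≤ k n (G.cpt e t) at this
      rw [hab t htI, ha] at this
      by_contra! hb
      nlinarith
    · rw [htest, hfv, hd1]; ring
  constructor
  · by_cases hex : ∃ n, ((G.vtx (G.src e) : G.Point) : G.Completion) ∈
      Metric.thickening (ε / 3) (F n)
    · obtain ⟨n, hn⟩ := hex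
      obtain ⟨p, hp, hd⟩ := Metric.mem_thickening_iff.1 hn
      obtain ⟨c, hc⟩ := h.multiple n p hp
      obtain ⟨a, b, hab⟩ := (h.robin n).harmonic.affine e
      rcases (h.minimal_of_mem_thickening hn).eq_or_lt with hk | hk
      · obtain ⟨hb, heq⟩ := main n p c a b hp (by rwa [cpt_zero]) hc hab
          (by rw [cpt_zero, hk])
        rw [← heq]
        have := (h.robin n).pos
        positivity
      · rw [h.testFun_eq σ σ₀ hn (hc _ (by linarith)), truncation_of_lt hσ₀ (hsep n hk),
          hc _ (by linarith), sub_self, zero_mul]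
    · rw [testFun, cutWeight, dif_neg hex]
      simp
  · intro n a b hab hf hn hkC
    obtain ⟨p, hp, hd⟩ := Metric.mem_thickening_iff.1 hn
    obtain ⟨hb, heq⟩ := main n p 1 a b hp hd (fun x hx => by rw [one_mul, hf p hp x hx]) hab hkC
    exact ⟨hb, by rw [← heq]; ring⟩

/-- The mirror image of `src_term_nonneg`: at the terminal end the slope into the edge is -b, so the
signs are reversed. -/
theorem tgt_term_nonneg (h : G.IsLocallyMultiple δ ε F₀ F k C f) {σ σ₀ : ℝ} (hσ : 0 < σ)
    (hσ₀ : σ ≤ σ₀) {e : E} (hsep : ∀ n, C n < k n (G.vtx (G.tgt e) : G.Point) →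
      C n + σ₀ < k n (G.vtx (G.tgt e) : G.Point)) :
    (f (G.vtx (G.tgt e)) - testFun F k C (ε / 3) f σ σ₀ (G.tgt e)) * G.tgtDeriv f e ≤ 0 ∧
    ∀ n a b, (∀ t ∈ Icc 0 (G.len e), k n (G.cpt e t) = a + b * t) →
      (∀ p ∈ F n, ∀ x : G.Point, dist (x : G.Completion) p < ε → f x = k n x) →
      G.cpt e (G.len e) ∈ Metric.thickening (ε / 3) (F n) → k n (G.cpt e (G.len e)) = C n →
      b ≤ 0 ∧
      C n * b = (f (G.vtx (G.tgt e)) - testFun F k C (ε / 3) f σ σ₀ (G.tgt e)) *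
        G.tgtDeriv f e := by
  have hε := h.pos
  have hl := G.len_pos e
  have hl1 : G.len e ∈ Icc 0 (G.len e) := right_mem_Icc.2 hl.le
  have main : ∀ n p c a b, p ∈ F n → dist (G.cpt e (G.len e)) p < ε / 3 →
      (∀ x : G.Point, dist (x : G.Completion) p < ε → f x = c * k n x) →
      (∀ t ∈ Icc 0 (G.len e), k n (G.cpt e t) = a + b * t) → k n (G.cpt e (G.len e)) = C n →
      b ≤ 0 ∧ c ^ 2 * (C n * b) =
        (f (G.vtx (G.tgt e)) - testFun F k C (ε / 3) f σ σ₀ (G.tgt e)) * G.tgtDeriv f e := by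
    intro n p c a b hp hd hc hab hkC
    have hdist : ∀ t ∈ Icc 0 (G.len e), G.len e - t < ε / 3 → dist (G.cpt e t) p < ε := by
      intro t ht ht'
      have h2 := dist_cpt_le e ht hl1
      rw [abs_sub_comm, abs_of_nonneg (sub_nonneg.2 ht.2)] at h2
      have := dist_triangle (G.cpt e t) (G.cpt e (G.len e)) p
      linarith [ht.2]
    have ha : a + b * G.len e = C n := by rw [← hkC, hab _ hl1]
    have hd1 : G.tgtDeriv f e = c * b :=
      tgtDeriv_of_affine_near (a := c * a) (by positivity : 0 < ε / 3) fun t ht ht' => by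
        rw [hc _ (hdist t ht ht')]
        change c * k n (G.cpt e t) = _
        rw [hab t ht]; ring
    have hfv : f (G.vtx (G.tgt e)) = c * C n := by
      rw [← pt_len, hc _ (hdist _ hl1 (by rw [sub_self]; positivity))]
      change c * k n (G.cpt e (G.len e)) = _
      rw [hkC]
    rw [cpt_len] at hd hkC
    have htest := h.testFun_eq σ σ₀ (Metric.mem_thickening_iff.2 ⟨p, hp, hd⟩)
      (by rw [hkC, hfv] : f (G.vtx (G.tgt e)) = c * k n (G.vtx (G.tgt e) : G.Point))
    rw [hkC, truncation_of_le hσ₀ (by linarith), mul_zero] at htest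
    constructor
    · set t := min (G.len e) (ε / 6)
      have ht0 : 0 < t := lt_min hl (by positivity)
      have htI : G.len e - t ∈ Icc 0 (G.len e) :=
        ⟨sub_nonneg.2 (min_le_left _ _), by linarith⟩
      have := h.minimal n p hp (G.pt e (G.len e - t)) (hdist _ htI (by
        have : t ≤ ε / 6 := min_le_right _ _
        linarith))
      change C n ≤ k n (G.cpt e (G.len e - t)) at this
      rw [hab _ htI] at this
      by_contra! hb
      nlinarith
    · rw [htest, hfv, hd1]; ring
  constructor
  · by_cases hex : ∃ n, ((G.vtx (G.tgt e) : G.Point) : G.Completion) ∈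
      Metric.thickening (ε / 3) (F n)
    · obtain ⟨n, hn⟩ := hex
      obtain ⟨p, hp, hd⟩ := Metric.mem_thickening_iff.1 hn
      obtain ⟨c, hc⟩ := h.multiple n p hp
      obtain ⟨a, b, hab⟩ := (h.robin n).harmonic.affine e
      rcases (h.minimal_of_mem_thickening hn).eq_or_lt with hk | hk
      · obtain ⟨hb, heq⟩ := main n p c a b hp (by rwa [cpt_len]) hc hab
          (by rw [cpt_len, hk])
        rw [← heq]
        exact mul_nonpos_of_nonneg_of_nonpos (sq_nonneg _)
          (mul_nonpos_of_nonneg_of_nonpos (h.robin n).pos.le hb)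
      · rw [h.testFun_eq σ σ₀ hn (hc _ (by linarith)), truncation_of_lt hσ₀ (hsep n hk),
          hc _ (by linarith), sub_self, zero_mul]
    · rw [testFun, cutWeight, dif_neg hex]
      simp
  · intro n a b hab hf hn hkC
    obtain ⟨p, hp, hd⟩ := Metric.mem_thickening_iff.1 hn
    obtain ⟨hb, heq⟩ := main n p 1 a b hp hd (fun x hx => by rw [one_mul, hf p hp x hx]) hab hkC
    exact ⟨hb, by rw [← heq]; ring⟩

variable (G) in
/-- `σ₀` separates the boundary values from the other values of the `k n` at the ends of the
edges in `S`. -/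
def _root_.MetricGraph.Separates (k : Fin N → G.Completion → ℝ) (C : Fin N → ℝ) (S : Set E)
    (σ₀ : ℝ) : Prop :=
  ∀ e ∈ S, ∀ n,
    (C n < k n (G.vtx (G.src e) : G.Point) → C n + σ₀ < k n (G.vtx (G.src e) : G.Point)) ∧
    (C n < k n (G.vtx (G.tgt e) : G.Point) → C n + σ₀ < k n (G.vtx (G.tgt e) : G.Point))

theorem _root_.MetricGraph.Separates.mono {S : Set E} {σ σ₀ : ℝ}
    (h : G.Separates k C S σ₀) (hσ : σ ≤ σ₀) : G.Separates k C S σ := fun e he n =>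
  ⟨fun h' => by linarith [(h e he n).1 h'], fun h' => by linarith [(h e he n).2 h']⟩

variable (G) in
theorem _root_.MetricGraph.exists_separates (k : Fin N → G.Completion → ℝ) (C : Fin N → ℝ)
    {S : Set E} (hS : S.Finite) : ∃ σ₀ > 0, G.Separates k C S σ₀ := by
  obtain ⟨σ, hσ, h⟩ := exists_separation (G := G) k C ((hS.image G.src).union (hS.image G.tgt))
  exact ⟨σ, hσ, fun e he n => ⟨h _ (.inl ⟨e, he, rfl⟩) n, h _ (.inr ⟨e, he, rfl⟩) n⟩⟩

theorem edgeEnergy_le_greenTerm_of_far (h : G.IsLocallyMultiple δ ε F₀ F k C f) {σ σ₀ : ℝ}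
    (hσ : 0 < σ) (hσ₀ : σ ≤ σ₀) (hsep : G.Separates k C (G.farEdges (ε / 3)) σ₀) {e : E}
    (he : e ∈ G.farEdges (ε / 3)) :
    G.edgeEnergy f e ≤ G.greenTerm f (testFun F k C (ε / 3) f σ σ₀) e := by
  have h1 := (h.src_term_nonneg hσ hσ₀ fun n => (hsep e he n).1).1
  have h2 := (h.tgt_term_nonneg hσ hσ₀ fun n => (hsep e he n).2).1
  rw [greenTerm]
  linarith

/-- On a far edge both end terms are nonnegative. On an edge near F n, b has the sign of the
increment of k n and the truncation is monotone; it increases at least as much as the identity if σ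
is below the gaps at the two ends. This σ depends on the edge, whereas nonnegativity holds on all
edges at once. -/
theorem greenTerm_nonneg (h : G.IsLocallyMultiple δ ε F₀ F k C f) {σ σ₀ : ℝ}
    (hσ : 0 < σ) (hσ₀ : σ ≤ σ₀) (hsep : G.Separates k C (G.farEdges (ε / 3)) σ₀) (e : E) :
    0 ≤ G.greenTerm f (testFun F k C (ε / 3) f σ σ₀) e ∧
    (G.Separates k C {e} σ →
      G.edgeEnergy f e ≤ G.greenTerm f (testFun F k C (ε / 3) f σ σ₀) e) := by
  by_cases he : e ∈ G.farEdges (ε / 3)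
  · have := h.edgeEnergy_le_greenTerm_of_far hσ hσ₀ hsep he
    exact ⟨(edgeEnergy_nonneg f e).trans this, fun _ => this⟩
  rcases h.near_edge he with h1 | ⟨n, c, h1, h2, h3⟩
  · have h1' : ∀ t ∈ Icc 0 (G.len e), f (G.pt e t) = 0 + 0 * t := fun t ht => by
      rw [h1 t ht]; ring
    rw [greenTerm_of_affine _ h1', edgeEnergy_of_affine h1']
    simp
  · obtain ⟨a, b, hab⟩ := (h.robin n).harmonic.affine e
    obtain ⟨hgreen, henergy⟩ := h.greenTerm_near σ σ₀ h1 hab h2 h3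
    rw [hgreen, henergy]
    have hl := G.len_pos e
    have hC := (h.robin n).pos.le
    have hdiff : k n (G.cpt e (G.len e)) - k n (G.cpt e 0) = b * G.len e := by
      rw [hab _ (right_mem_Icc.2 hl.le), hab _ (left_mem_Icc.2 hl.le)]; ring
    have hx : C n ≤ k n (G.cpt e 0) := h.minimal_of_mem_thickening h2
    have hy : C n ≤ k n (G.cpt e (G.len e)) := h.minimal_of_mem_thickening h3
    have hsep' : G.Separates k C {e} σ → (C n < k n (G.cpt e 0) → C n + σ < k n (G.cpt e 0)) ∧
        (C n < k n (G.cpt e (G.len e)) → C n + σ < k n (G.cpt e (G.len e))) := by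
      rw [cpt_zero, cpt_len]
      exact fun h => h e rfl n
    set x := k n (G.cpt e 0)
    set y := k n (G.cpt e (G.len e))
    rcases lt_trichotomy b 0 with hb | rfl | hb
    · have hyx : y < x := by nlinarith
      refine ⟨mul_nonneg (sq_nonneg _) (mul_nonneg_of_nonpos_of_nonpos hb.le
        (sub_nonpos.2 (truncation_mono hC hy hyx.le))), fun hs => ?_⟩
      have := sub_le_truncation_sub (σ₀ := σ₀) hC hy hyx.le ((hsep' hs).1 (by linarith))
      exact mul_le_mul_of_nonneg_left (mul_le_mul_of_nonpos_left (by linarith) hb.le)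
        (sq_nonneg _)
    · simp
    · have hyx : x < y := by nlinarith
      refine ⟨mul_nonneg (sq_nonneg _) (mul_nonneg hb.le
        (sub_nonneg.2 (truncation_mono hC hx hyx.le))), fun hs => ?_⟩
      have := sub_le_truncation_sub (σ₀ := σ₀) hC hx hyx.le ((hsep' hs).2 (by linarith))
      exact mul_le_mul_of_nonneg_left (mul_le_mul_of_nonneg_left (by linarith) hb.le)
        (sq_nonneg _)

/-- No Kirchhoff condition is imposed at boundary vertices, so the test function must vanish there:
either f = 0, or k n = C n is truncated to 0. -/
theorem testFun_eq_zero_of_mem_bdry (h : G.IsLocallyMultiple δ ε F₀ F k C f) {σ σ₀ : ℝ}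
    (hσ : 0 < σ) (hσ₀ : σ ≤ σ₀) {v : V} (hv : v ∈ G.bdry) :
    testFun F k C (ε / 3) f σ σ₀ v = 0 := by
  have hε := h.pos
  have hb := vtx_mem_boundary hv
  rw [← h.partition.cover] at hb
  rcases hb with hb | hb
  · rw [testFun, h.zero _ hb (G.vtx v) (by rwa [dist_self]), zero_mul]
  · obtain ⟨n, hn⟩ := mem_iUnion.1 hb
    rw [testFun, h.cutWeight_eq σ σ₀ (Metric.self_subset_thickening (by positivity) _ hn),
      (h.robin n).eq_on _ hn, truncation_of_le hσ₀ (by linarith)]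
    simp

/-- Uniformly close to F n the values of k n are below C n + σ, where the truncation is zero;
finitely many edges remain. -/
theorem exists_finite_support [CompactSpace G.Completion]
    (h : G.IsLocallyMultiple δ ε F₀ F k C f) {σ σ₀ : ℝ} (hσ : 0 < σ) (hσ₀ : σ ≤ σ₀) :
    ∃ T : Set E, T.Finite ∧ ∀ e ∉ T, testFun F k C (ε / 3) f σ σ₀ (G.src e) = 0 ∧
      testFun F k C (ε / 3) f σ σ₀ (G.tgt e) = 0 ∧
      ∃ a b, ∀ t ∈ Icc 0 (G.len e), f (G.pt e t) = a + b * t := by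
  have hε := h.pos
  obtain ⟨r, hr, hlt⟩ := exists_radius h.robin hσ
  -- The radius must not exceed δ, so that closeness to the boundary means closeness to the right F
  -- n.
  have hr' : 0 < min r δ := lt_min hr (hε.trans_le h.le)
  refine ⟨G.farEdges (ε / 3) ∪ G.farEdges (min r δ),
    (finite_farEdges (by positivity)).union (finite_farEdges hr'), fun e he => ?_⟩
  have he1 : e ∉ G.farEdges (ε / 3) := fun h => he (.inl h)
  have he2 : e ∉ G.farEdges (min r δ) := fun h => he (.inr h)
  have hl := G.len_pos e
  have hl0 : (0 : ℝ) ∈ Icc 0 (G.len e) := left_mem_Icc.2 hl.le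
  have hl1 : G.len e ∈ Icc 0 (G.len e) := right_mem_Icc.2 hl.le
  refine and_assoc.1 ⟨?_, h.affine_of_notMem_farEdges he1⟩
  rcases h.near_edge he1 with h1 | ⟨n, c, h1, h2, h3⟩
  · have e0 := h1 0 hl0
    have e1 := h1 _ hl1
    rw [pt_zero] at e0
    rw [pt_len] at e1
    simp [testFun, e0, e1]
  · have key : ∀ t ∈ Icc 0 (G.len e), G.cpt e t ∈ Metric.thickening (ε / 3) (F n) →
        truncation (C n) σ σ₀ (k n (G.cpt e t)) = 0 := by
      intro t ht htn
      refine truncation_of_le hσ₀ (hlt n _ (Metric.thickening_mono (min_le_left r δ) _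
        (h.partition.mem_thickening_of_boundary h.third_le (min_le_right r δ) htn ?_))).le
      by_contra hcon
      exact he2 ⟨t, ht, hcon⟩
    have e0 := h1 0 hl0
    have e1 := h1 _ hl1
    have k0 := key 0 hl0 h2
    have k1 := key _ hl1 h3
    rw [pt_zero, cpt_zero] at e0
    rw [pt_len, cpt_len] at e1
    rw [cpt_zero] at h2 k0
    rw [cpt_len] at h3 k1
    rw [h.testFun_eq σ σ₀ h2 e0, h.testFun_eq σ σ₀ h3 e1, k0, k1]
    simp

theorem exists_inner_eq_sum [CompactSpace G.Completion]
    (h : G.IsLocallyMultiple δ ε F₀ F k C f) (hf : G.MemDMax f) {σ σ₀ : ℝ}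
    (hσ : 0 < σ) (hσ₀ : σ ≤ σ₀) (S : Finset E) :
    ∃ T : Finset E, S ⊆ T ∧ inner ℝ (G.negD2 hf) (G.toL2 hf) =
      ∑ e ∈ T, G.greenTerm f (testFun F k C (ε / 3) f σ σ₀) e := by
  classical
  obtain ⟨T, hT, h1⟩ := h.exists_finite_support hσ hσ₀
  have hnot : ∀ e ∉ hT.toFinset ∪ S, e ∉ T := fun e he h' =>
    he (Finset.mem_union_left _ (hT.mem_toFinset.2 h'))
  exact ⟨hT.toFinset ∪ S, Finset.subset_union_right, hf.inner_eq_sum_greenTerm _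
    (fun v hv => h.testFun_eq_zero_of_mem_bdry hσ hσ₀ hv) _
    (fun e he => ⟨(h1 e (hnot e he)).1, (h1 e (hnot e he)).2.1⟩)
    (fun e he => (h1 e (hnot e he)).2.2)⟩

theorem inner_nonneg [CompactSpace G.Completion]
    (h : G.IsLocallyMultiple δ ε F₀ F k C f) (hf : G.MemDMax f) :
    0 ≤ inner ℝ (G.negD2 hf) (G.toL2 hf) := by
  obtain ⟨σ₀, hσ₀, hsep⟩ := G.exists_separates k C
    (finite_farEdges (G := G) (by linarith [h.pos] : 0 < ε / 3))
  obtain ⟨T, -, hT⟩ := h.exists_inner_eq_sum hf hσ₀ le_rfl ∅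
  rw [hT]
  exact Finset.sum_nonneg fun e _ => (h.greenTerm_nonneg hσ₀ le_rfl hsep e).1

/-- If one edge contributes a surplus to Green's formula, so does the whole graph. -/
theorem integral_add_le_inner [CompactSpace G.Completion]
    (h : G.IsLocallyMultiple δ ε F₀ F k C f) (hf : G.MemDMax f)
    (hf' : MemLp (edgeDeriv (G.comp f)) 2 G.edgeMeasure) {σ₀ γ : ℝ} (hσ₀ : 0 < σ₀)
    (hsep : G.Separates k C (G.farEdges (ε / 3)) σ₀) {e₀ : E}
    (hγ : ∀ σ, 0 < σ → σ ≤ σ₀ →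
      G.edgeEnergy f e₀ + γ ≤ G.greenTerm f (testFun F k C (ε / 3) f σ σ₀) e₀) :
    ∫ q, (edgeDeriv (G.comp f) q) ^ 2 ∂G.edgeMeasure + γ ≤
      inner ℝ (G.negD2 hf) (G.toL2 hf) := by
  classical
  have hsum := hasSum_integral_edges hf'.integrable_sq
  rw [← le_sub_iff_add_le]
  -- It suffices to bound the partial energy sums over finite S containing e₀. For each S a new σ is
  -- chosen below the gaps on S; σ₀ stays fixed and with it the surplus γ.
  refine le_of_tendsto hsum ((eventually_ge_atTop {e₀}).mono fun S hS => ?_)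
  have he₀ : e₀ ∈ S := hS (Finset.mem_singleton_self _)
  obtain ⟨σ₁, hσ₁, hsep₁⟩ := G.exists_separates k C S.finite_toSet
  have hσ : 0 < min σ₁ σ₀ := lt_min hσ₁ hσ₀
  obtain ⟨T, hST, hT⟩ := h.exists_inner_eq_sum hf hσ (min_le_right _ _) S
  rw [le_sub_iff_add_le, hT]
  refine le_trans ?_ (Finset.sum_le_sum_of_subset_of_nonneg hST fun e _ _ =>
    (h.greenTerm_nonneg hσ (min_le_right _ _) hsep e).1)
  rw [← Finset.add_sum_erase _ _ he₀, ← Finset.add_sum_erase (a := e₀) _ _ he₀,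
    add_right_comm]
  refine add_le_add (hγ _ hσ (min_le_right _ _)) (Finset.sum_le_sum fun e he => ?_)
  refine (h.greenTerm_nonneg hσ (min_le_right _ _) hsep e).2
    (Separates.mono (fun e' he' => ?_) (min_le_left _ _))
  rw [mem_singleton_iff.1 he']
  exact hsep₁ e (Finset.mem_of_mem_erase he)

end IsLocallyMultiple


/-! ### An edge with a surplus -/

/-- A path along which a harmonic function is not constant contains an edge on which it is not
constant. -/
theorem HasPath.exists_slope_ne_zero {h : G.Completion → ℝ} (hh : G.IsHarmonic h)
    {x y : G.Point} {L : ℝ} (hpath : G.HasPath x y L) {p : G.Completion} {R : ℝ}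
    (hL : dist (x : G.Completion) p + L < R) (hxy : h x ≠ h y) :
    ∃ e, ∃ s ∈ Icc 0 (G.len e), dist (G.cpt e s) p < R ∧
      ∃ a b, b ≠ 0 ∧ ∀ t ∈ Icc 0 (G.len e), h (G.cpt e t) = a + b * t := by
  induction hpath with
  | refl x => exact absurd rfl hxy
  | step e s t y L hs ht hpath ih =>
    have hL0 := hpath.nonneg
    change dist (G.cpt e s) p + _ < R at hL
    by_cases hst : h (G.cpt e s) = h (G.cpt e t)
    · refine ih ?_ ?_
      · have h1 := dist_cpt_le e ht hs
        have h2 := dist_triangle (G.cpt e t) (G.cpt e s) p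
        rw [abs_sub_comm t s] at h1
        change dist (G.cpt e t) p + _ < R
        linarith
      · change h (G.cpt e t) ≠ h y
        rwa [← hst]
    · obtain ⟨a, b, hab⟩ := hh.affine e
      refine ⟨e, s, hs, by linarith [abs_nonneg (s - t)], a, b, ?_, hab⟩
      rintro rfl
      rw [hab s hs, hab t ht] at hst
      simp at hst

/-- Nonconstancy gives a graph point x near some p in A with h x ≠ C. By continuity h differs from h
x near p, so a short path from x to a graph point near p meets an edge with nonzero slope. -/
theorem IsRobinFunction.exists_slope_ne_zero {h : G.Completion → ℝ} {A : Set G.Completion} {C : ℝ}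
    (hh : G.IsRobinFunction h A C) {R : ℝ} (hR : 0 < R) :
    ∃ p ∈ A, ∃ e, ∃ s ∈ Icc 0 (G.len e), dist (G.cpt e s) p < R ∧
      ∃ a b, b ≠ 0 ∧ ∀ t ∈ Icc 0 (G.len e), h (G.cpt e t) = a + b * t := by
  have hcont := hh.harmonic.continuous
  obtain ⟨x', hx', hne'⟩ := hh.nonconstant (R / 4) (by positivity)
  obtain ⟨x, hxA, hxC⟩ : ∃ x : G.Point, (x : G.Completion) ∈ Metric.thickening (R / 4) A ∧
      h x ≠ C := by
    have hopen : IsOpen (Metric.thickening (R / 4) A ∩ {y | h y ≠ C}) :=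
      Metric.isOpen_thickening.inter (isOpen_ne_fun hcont continuous_const)
    obtain ⟨x, hx⟩ :=
      UniformSpace.Completion.denseRange_coe.exists_mem_open hopen ⟨x', hx', hne'⟩
    exact ⟨x, hx⟩
  obtain ⟨p, hp, hxp⟩ := Metric.mem_thickening_iff.1 hxA
  have hnear : {y | h y ≠ h x} ∈ 𝓝 p :=
    (isOpen_ne_fun hcont continuous_const).mem_nhds (by
      change h p ≠ h x
      rw [hh.eq_on p hp]; exact hxC.symm)
  obtain ⟨ρ, hρ, hball⟩ := Metric.mem_nhds_iff.1 hnear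
  obtain ⟨z, hz⟩ := exists_point_near p (lt_min hρ (by positivity : 0 < R / 4))
  rw [lt_min_iff] at hz
  have hxz : dist x z < R / 2 := by
    rw [← UniformSpace.Completion.dist_eq]
    have := dist_triangle_right (x : G.Completion) z p
    linarith
  obtain ⟨L, hL, hL'⟩ := exists_hasPath_lt hxz
  exact ⟨p, hp, hL.exists_slope_ne_zero hh.harmonic (by linarith)
    (Ne.symm (hball (Metric.mem_ball.2 hz.1)))⟩

/-- If `f` agrees with `k n` close to `F n`, some edge contributes a surplus to Green's formula. -/
theorem IsLocallyMultiple.exists_surplus [CompactSpace G.Completion] {N : ℕ} {δ ε : ℝ}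
    {F₀ : Set G.Completion} {F : Fin N → Set G.Completion} {k : Fin N → G.Completion → ℝ}
    {C : Fin N → ℝ} {f : G.Point → ℝ} (h : G.IsLocallyMultiple δ ε F₀ F k C f) (n : Fin N)
    (hn : ∀ p ∈ F n, ∀ x : G.Point, dist (x : G.Completion) p < ε → f x = k n x) :
    ∃ σ₀ > 0, G.Separates k C (G.farEdges (ε / 3)) σ₀ ∧ ∃ e₀, ∃ γ > 0, ∀ σ, 0 < σ → σ ≤ σ₀ →
      G.edgeEnergy f e₀ + γ ≤ G.greenTerm f (testFun F k C (ε / 3) f σ σ₀) e₀ := by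
  have hε := h.pos
  have hC := (h.robin n).pos
  obtain ⟨σ₁, hσ₁, hsep⟩ := G.exists_separates k C
    (finite_farEdges (G := G) (by linarith : 0 < ε / 3))
  obtain ⟨r, hr, hlt⟩ := (h.robin n).exists_lt_of_mem_thickening hσ₁
  obtain ⟨p, hp, e, s, hs, hd, a, b, hb, hab⟩ :=
    (h.robin n).exists_slope_ne_zero (lt_min hr (by linarith : 0 < ε / 3))
  have hend : ∀ t, dist (G.cpt e t) p < min r (ε / 3) →
      G.cpt e t ∈ Metric.thickening (ε / 3) (F n) ∧ k n (G.cpt e t) < C n + σ₁ := by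
    intro t ht
    rw [lt_min_iff] at ht
    exact ⟨Metric.mem_thickening_iff.2 ⟨p, hp, ht.2⟩,
      hlt _ (Metric.mem_thickening_iff.2 ⟨p, hp, ht.1⟩)⟩
  have hl := G.len_pos e
  have hends : (G.cpt e 0 ∈ Metric.thickening (ε / 3) (F n) ∧ k n (G.cpt e 0) < C n + σ₁) ∨
      (G.cpt e (G.len e) ∈ Metric.thickening (ε / 3) (F n) ∧
        k n (G.cpt e (G.len e)) < C n + σ₁) := by
    refine (exists_end_near (h.partition.subset_boundary n hp) hs hd).imp
      (fun h => hend _ ?_) (fun h => hend _ ?_)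
    · linarith [hs.1]
    · linarith [hs.2]
  -- On a far edge, an end near F n with value below C n + σ₁ must have the value C n exactly, by
  -- separation; its end term is the surplus.
  by_cases he : e ∈ G.farEdges (ε / 3)
  · refine ⟨σ₁, hσ₁, hsep, e, C n * |b|, mul_pos hC (abs_pos.2 hb), fun σ hσ hσ' => ?_⟩
    have h1 := h.src_term_nonneg hσ hσ' fun n => (hsep e he n).1
    have h2 := h.tgt_term_nonneg hσ hσ' fun n => (hsep e he n).2
    rw [greenTerm]
    rcases hends with ⟨h3, h4⟩ | ⟨h3, h4⟩
    · have hmin : C n ≤ k n (G.cpt e 0) := h.minimal_of_mem_thickening h3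
      have heq : k n (G.cpt e 0) = C n := by
        by_contra hne
        have := (hsep e he n).1 (by rw [← cpt_zero]; exact lt_of_le_of_ne hmin (Ne.symm hne))
        rw [← cpt_zero] at this
        linarith
      obtain ⟨h5, h6⟩ := h1.2 n a b hab hn h3 heq
      rw [abs_of_nonneg h5, h6]
      linarith [h2.1]
    · have hmin : C n ≤ k n (G.cpt e (G.len e)) := h.minimal_of_mem_thickening h3
      have heq : k n (G.cpt e (G.len e)) = C n := by
        by_contra hne
        have := (hsep e he n).2 (by rw [← cpt_len]; exact lt_of_le_of_ne hmin (Ne.symm hne))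
        rw [← cpt_len] at this
        linarith
      obtain ⟨h5, h6⟩ := h2.2 n a b hab hn h3 heq
      rw [abs_of_nonpos h5, mul_neg, h6]
      linarith [h1.1]
  · have hl0 : (0 : ℝ) ∈ Icc 0 (G.len e) := left_mem_Icc.2 hl.le
    have hl1 : G.len e ∈ Icc 0 (G.len e) := right_mem_Icc.2 hl.le
    have hfk : ∀ t, G.cpt e t ∈ Metric.thickening (ε / 3) (F n) →
        f (G.pt e t) = k n (G.cpt e t) ∧ C n ≤ k n (G.cpt e t) := by
      intro t ht
      refine ⟨?_, h.minimal_of_mem_thickening ht⟩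
      obtain ⟨q, hq, hdq⟩ := Metric.mem_thickening_iff.1 ht
      exact hn q hq _ (lt_trans hdq (by linarith))
    obtain ⟨c, hc, h0, h1⟩ : ∃ c : ℝ,
        (∀ t ∈ Icc 0 (G.len e), f (G.pt e t) = c * k n (G.cpt e t)) ∧
        G.cpt e 0 ∈ Metric.thickening (ε / 3) (F n) ∧
        G.cpt e (G.len e) ∈ Metric.thickening (ε / 3) (F n) := by
      rcases h.near_edge he with hz | ⟨m, c, hc, h0, h1⟩
      · exfalso
        rcases hends with ⟨h3, -⟩ | ⟨h3, -⟩
        · have := hfk _ h3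
          rw [hz 0 hl0] at this
          linarith
        · have := hfk _ h3
          rw [hz _ hl1] at this
          linarith
      · have hmn : m = n := by
          rcases hends with ⟨h3, -⟩ | ⟨h3, -⟩
          · exact h.partition.eq_of_mem_thickening h.third_le h.third_le h0 h3
          · exact h.partition.eq_of_mem_thickening h.third_le h.third_le h1 h3
        subst hmn
        exact ⟨c, hc, h0, h1⟩
    have hx := (hfk _ h0).2
    have hy := (hfk _ h1).2
    -- Comparison at one end, where k n ≥ C n > 0, identifies the constant.
    have hc1 : c = 1 := by
      have h3 := (hfk _ h0).1
      rw [hc 0 hl0] at h3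
      exact mul_right_cancel₀ (hC.trans_le hx).ne' (h3.trans (one_mul _).symm)
    subst hc1
    have hdiff : k n (G.cpt e (G.len e)) - k n (G.cpt e 0) = b * G.len e := by
      rw [hab _ hl1, hab _ hl0]; ring
    -- the level `C n + σ₀` separates the values of `k n` at the two ends of `e`
    have hσ₀ : ∀ u w : ℝ, C n ≤ u → u < w → u < C n + σ₁ →
        ∃ σ₀, 0 < σ₀ ∧ σ₀ ≤ σ₁ ∧ u ≤ C n + σ₀ ∧ C n + σ₀ < w := by
      intro u w hu huw huσ
      have h3 : u < min w (C n + σ₁) := lt_min huw huσ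
      -- The level is the midpoint between the lower end value and the smaller of the upper one and
      -- C n + σ₁; the last bound preserves the separation on the far edges.
      refine ⟨(u + min w (C n + σ₁)) / 2 - C n, by linarith, ?_, by linarith, ?_⟩
      · linarith [min_le_right w (C n + σ₁)]
      · linarith [min_le_left w (C n + σ₁)]
    rcases lt_or_gt_of_ne hb with hb | hb
    · have hyx : k n (G.cpt e (G.len e)) < k n (G.cpt e 0) := by nlinarith
      obtain ⟨σ₀, hσ₀, hσ₀', h3, h4⟩ := hσ₀ _ _ hy hyx (by
        rcases hends with h3 | h3 <;> linarith [h3.2])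
      refine ⟨σ₀, hσ₀, hsep.mono hσ₀', e, C n * -b, mul_pos hC (neg_pos.2 hb),
        fun σ hσ hσ' => ?_⟩
      obtain ⟨hgreen, henergy⟩ := h.greenTerm_near σ σ₀ hc hab h0 h1
      have := sub_add_le_truncation_sub hσ' hy h3 h4
      rw [hgreen, henergy]
      nlinarith
    · have hyx : k n (G.cpt e 0) < k n (G.cpt e (G.len e)) := by nlinarith
      obtain ⟨σ₀, hσ₀, hσ₀', h3, h4⟩ := hσ₀ _ _ hx hyx (by
        rcases hends with h3 | h3 <;> linarith [h3.2])
      refine ⟨σ₀, hσ₀, hsep.mono hσ₀', e, C n * b, mul_pos hC hb,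
        fun σ hσ hσ' => ?_⟩
      obtain ⟨hgreen, henergy⟩ := h.greenTerm_near σ σ₀ hc hab h0 h1
      have := sub_add_le_truncation_sub hσ' hx h3 h4
      rw [hgreen, henergy]
      nlinarith

/-! ### Functions of the domain are locally multiples of the boundary functions -/

theorem IsSuccPartition.cover {P Q : Set (Set G.Completion)} (h : G.IsSuccPartition P Q)
    {A : Set G.Completion} (hA : A ∈ P) {p : G.Completion} (hp : p ∈ A) :
    ∃ B ∈ Q, p ∈ B ∧ B ⊆ A := by
  obtain ⟨l, r, hsplit, rfl⟩ := h
  rcases hsplit A hA with ⟨-, -, -, -, -, hu⟩ | ⟨-, hl, -⟩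
  · rw [← hu] at hp
    rcases hp with hp | hp
    · exact ⟨l A, .inl ⟨A, hA, rfl⟩, hp, subset_union_left.trans hu.subset⟩
    · exact ⟨r A, .inr ⟨A, hA, rfl⟩, hp, subset_union_right.trans hu.subset⟩
  · exact ⟨l A, .inl ⟨A, hA, rfl⟩, by rwa [hl], hl.subset⟩

theorem IsPartitionSequence.cover {N : ℕ} {F₀ : Set G.Completion} {F : Fin N → Set G.Completion}
    {P : ℕ → Set (Set G.Completion)} (hP : G.IsPartitionSequence F₀ F P) (j : ℕ) {n : Fin N}
    {p : G.Completion} (hp : p ∈ F n) : ∃ A ∈ P j, p ∈ A ∧ A ⊆ F n := by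
  induction j with
  | zero =>
    refine ⟨F n, ?_, hp, subset_rfl⟩
    rw [hP.1]
    exact ⟨.inr ⟨n, rfl⟩, (nonempty_of_mem hp).ne_empty⟩
  | succ j ih =>
    obtain ⟨A, hA, hpA, hAF⟩ := ih
    obtain ⟨B, hB, hpB, hBA⟩ := (hP.2 j).cover hA hpA
    exact ⟨B, hB, hpB, hBA.trans hAF⟩

/-- Every point of F n lies in a member of the j-th partition inside F n, whose constant is used at
that point; this treats all j alike. All small ε are allowed, so that ε can later be shrunk to where
f = k n. -/
theorem exists_isLocallyMultiple [Countable V] {N : ℕ} {δ : ℝ} {F₀ : Set G.Completion}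
    {F : Fin N → Set G.Completion} (hF : G.IsInitialPartition F₀ F δ)
    {k : Fin N → G.Completion → ℝ} {C : Fin N → ℝ}
    (hk : ∀ n, G.IsRobinFunction (k n) (F n) (C n))
    {P : ℕ → Set (Set G.Completion)} (hP : G.IsPartitionSequence F₀ F P) {j : ℕ}
    {f : G.Point → ℝ} (hf : f ∈ G.domain δ F₀ F k (P j)) :
    ∃ ε₀ > 0, ∀ ε, 0 < ε → ε ≤ ε₀ → G.IsLocallyMultiple δ ε F₀ F k C f := by
  obtain ⟨-, ε₁, hε₁, hε₁δ, hzero, hmult⟩ := hf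
  choose ρ hρ hmin using fun n =>
    (hk n).posNormalDeriv.exists_forall_le (hk n).harmonic (hk n).eq_on
  obtain ⟨ε₂, hε₂, hle⟩ := (finite_univ (α := Fin N)).exists_pos_forall_le (f := ρ)
    fun n _ => hρ n
  refine ⟨min ε₁ ε₂, lt_min hε₁ hε₂, fun ε hε hεle => ?_⟩
  rw [le_min_iff] at hεle
  refine ⟨hF, hk, hε, hεle.1.trans hε₁δ.le, fun p hp x hx => ?_, fun n p hp => ?_,
    fun n p hp x hx => ?_⟩
  · exact hzero x (Metric.mem_thickening_iff.2 ⟨p, hp, hx.trans_le hεle.1⟩)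
  · obtain ⟨A, hA, hpA, hAF⟩ := hP.cover j hp
    obtain ⟨c, hc⟩ := hmult A hA n hAF
    exact ⟨c, fun x hx => hc x (Metric.mem_thickening_iff.2 ⟨p, hpA, hx.trans_le hεle.1⟩)⟩
  · exact hmin n p hp x (hx.trans_le (hεle.2.trans (hle n (mem_univ _))))

theorem isNonnegOp_domain [Countable V] [CompactSpace G.Completion] {N : ℕ} {δ : ℝ}
    {F₀ : Set G.Completion} {F : Fin N → Set G.Completion} (hF : G.IsInitialPartition F₀ F δ)
    {k : Fin N → G.Completion → ℝ} {C : Fin N → ℝ}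
    (hk : ∀ n, G.IsRobinFunction (k n) (F n) (C n))
    {P : ℕ → Set (Set G.Completion)} (hP : G.IsPartitionSequence F₀ F P) (j : ℕ) :
    G.IsNonnegOp (G.operatorOn (G.domain δ F₀ F k (P j))) := by
  rintro _ ⟨f, hfD, hf, rfl⟩
  obtain ⟨ε, hε, h⟩ := exists_isLocallyMultiple hF hk hP hfD
  exact (h ε hε le_rfl).inner_nonneg hf

theorem lt_inner_of_eq_boundary_function [Countable V] [CompactSpace G.Completion] {N : ℕ} {δ : ℝ}
    {F₀ : Set G.Completion} {F : Fin N → Set G.Completion} (hF : G.IsInitialPartition F₀ F δ)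
    {k : Fin N → G.Completion → ℝ} {C : Fin N → ℝ}
    (hk : ∀ n, G.IsRobinFunction (k n) (F n) (C n))
    {P : ℕ → Set (Set G.Completion)} (hP : G.IsPartitionSequence F₀ F P) {j : ℕ}
    {f : G.Point → ℝ} (hfD : f ∈ G.domain δ F₀ F k (P j)) (hf : G.MemDMax f)
    (hf' : MemLp (edgeDeriv (G.comp f)) 2 G.edgeMeasure) {n : Fin N} {ε₁ : ℝ} (hε₁ : 0 < ε₁)
    (hn : ∀ x : G.Point, (x : G.Completion) ∈ Metric.thickening ε₁ (F n) → f x = k n x) :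
    ∫ q, (edgeDeriv (G.comp f) q) ^ 2 ∂G.edgeMeasure < inner ℝ (G.negD2 hf) (G.toL2 hf) := by
  obtain ⟨ε₀, hε₀, h⟩ := exists_isLocallyMultiple hF hk hP hfD
  have hε : 0 < min ε₀ ε₁ := lt_min hε₀ hε₁
  have hloc := h _ hε (min_le_left _ _)
  obtain ⟨σ₀, hσ₀, hsep, e₀, γ, hγ, hgain⟩ := hloc.exists_surplus n fun p hp x hx =>
    hn x (Metric.mem_thickening_iff.2 ⟨p, hp, hx.trans_le (min_le_right _ _)⟩)
  linarith [hloc.integral_add_le_inner hf hf' hσ₀ hsep hgain]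

end MetricGraph

theorem Set.Finite.exists_forall_le_of_forall_exists {ι α : Type*} {s : Set ι} (hs : s.Finite)
    {t : ι → Set α} {u : ι → α → ℝ} (h : ∀ i ∈ s, ∃ M, ∀ x ∈ t i, u i x ≤ M) :
    ∃ M, 0 ≤ M ∧ ∀ i ∈ s, ∀ x ∈ t i, u i x ≤ M := by
  choose! M hM using h
  obtain ⟨K, hK⟩ := (hs.image M).bddAbove
  exact ⟨max K 0, le_max_right _ _, fun i hi x hx =>
    (hM i hi x hx).trans ((hK ⟨i, hi, rfl⟩).trans (le_max_left _ _))⟩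

namespace MetricGraph

variable {V E : Type*} {G : MetricGraph V E}

/-! ### Continuity and measurability -/

theorem continuous_pt (e : E) : Continuous (G.pt e) := by
  have hl := (G.len_pos e).le
  have hcl : ∀ t : ℝ, max 0 (min t (G.len e)) ∈ Icc 0 (G.len e) := fun t =>
    ⟨le_max_left _ _, max_le hl (min_le_right _ _)⟩
  have hpt : G.pt e = fun t => G.pt e (max 0 (min t (G.len e))) := by
    funext t
    rcases le_total t 0 with ht | ht
    · rw [pt_of_nonpos ht, min_eq_left (ht.trans hl), max_eq_left ht, pt_zero]
    rcases le_total t (G.len e) with ht' | ht'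
    · rw [min_eq_left ht', max_eq_right ht]
    · rw [pt_of_len_le ht', min_eq_right ht', max_eq_right hl, pt_len]
  have hcont : ContinuousOn (G.pt e) (Icc 0 (G.len e)) := by
    have : LipschitzOnWith 1 (G.pt e) (Icc 0 (G.len e)) :=
      LipschitzOnWith.of_dist_le_mul fun s hs t ht => by
        simpa [Real.dist_eq] using dist_pt_le e hs ht
    exact this.continuousOn
  rw [hpt]
  exact hcont.comp_continuous (by fun_prop) hcl

/-- A Lipschitz constant common to all edges adds up along paths and so holds for the geodesic
distance. -/
theorem continuous_of_edgewise_lipschitz {u : G.Point → ℝ} {K : ℝ} (hK : 0 ≤ K)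
    (hu : ∀ e, ∀ s ∈ Icc 0 (G.len e), ∀ t ∈ Icc 0 (G.len e),
      |u (G.pt e s) - u (G.pt e t)| ≤ K * |s - t|) : Continuous u := by
  have hpath : ∀ {x y : G.Point} {L : ℝ}, G.HasPath x y L → |u x - u y| ≤ K * L := by
    intro x y L h
    induction h with
    | refl x => simp
    | step e s t y L hs ht h ih =>
      have := abs_sub_le (u (G.pt e s)) (u (G.pt e t)) (u y)
      linarith [hu e s hs t ht]
  refine Metric.continuous_iff.2 fun x ε hε => ⟨ε / (K + 1), by positivity, fun y hy => ?_⟩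
  obtain ⟨L, hL, hL'⟩ := exists_hasPath_lt hy
  rw [lt_div_iff₀ (by positivity)] at hL'
  rw [Real.dist_eq]
  linarith [hpath hL, hL.nonneg]

theorem measurable_comp {f : G.Point → ℝ} (hf : Continuous f) : Measurable (G.comp f) :=
  Sigma.measurable_iff.2 fun e => (hf.comp (continuous_pt e)).measurable

theorem measurable_edgeDeriv (g : (Σ _ : E, ℝ) → ℝ) : Measurable (edgeDeriv g) :=
  Sigma.measurable_iff.2 fun e => measurable_deriv fun t => g ⟨e, t⟩

theorem edgeMeasure_edges_lt_top {B : Set E} (hB : B.Finite) :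
    G.edgeMeasure {q | q.1 ∈ B} < ⊤ := by
  have : {q : Σ _ : E, ℝ | q.1 ∈ B} = ⋃ e ∈ B, {q | q.1 = e} := by
    ext q
    simp
  rw [this]
  refine measure_biUnion_lt_top hB fun e _ => ?_
  have hmeas : MeasurableSet {q : Σ _ : E, ℝ | q.1 = e} :=
    MeasurableSpace.measurableSet_iInf.2 fun i => by
      change MeasurableSet {t : ℝ | i = e}
      exact MeasurableSet.const _
  rw [edgeMeasure, Measure.sum_apply _ hmeas, tsum_eq_single e]
  · rw [(Sigma.measurableEmbedding_mk e).map_apply]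
    refine (measure_mono (subset_univ _)).trans_lt ?_
    simp
  · intro e' he'
    rw [(Sigma.measurableEmbedding_mk e').map_apply]
    have : (fun t : ℝ => (⟨e', t⟩ : Σ _ : E, ℝ)) ⁻¹' {q | q.1 = e} = ∅ := by
      ext t
      simp [he']
    rw [this, measure_empty]

/-- A bounded function supported, up to a square integrable function, in a set of finite measure is
square integrable. -/
theorem memLp_of_le_add_indicator {g h : (Σ _ : E, ℝ) → ℝ} (hg : Measurable g)
    (hh : MemLp h 2 G.edgeMeasure) {S : Set (Σ _ : E, ℝ)} (hS : G.edgeMeasure S < ⊤) {M : ℝ}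
    (hM : 0 ≤ M) (hle : ∀ᵐ q ∂G.edgeMeasure, |g q| ≤ |h q| ∨ q ∈ S ∧ |g q| ≤ M) :
    MemLp g 2 G.edgeMeasure := by
  -- The set S is not assumed measurable; its measurable hull has the same measure.
  have hS' : G.edgeMeasure (toMeasurable G.edgeMeasure S) ≠ ⊤ := by
    rw [measure_toMeasurable]; exact hS.ne
  have hind := memLp_indicator_const (μ := G.edgeMeasure) 2
    (measurableSet_toMeasurable G.edgeMeasure S) M (.inr hS')
  refine (hh.abs.add hind).mono hg.aestronglyMeasurable ?_
  filter_upwards [hle] with q hq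
  have h0 : 0 ≤ (toMeasurable G.edgeMeasure S).indicator (fun _ => M) q :=
    indicator_nonneg (fun _ _ => hM) _
  rw [Real.norm_eq_abs, Real.norm_eq_abs, Pi.add_apply, Pi.abs_apply,
    abs_of_nonneg (add_nonneg (abs_nonneg _) h0)]
  rcases hq with hq | ⟨hqS, hq⟩
  · exact hq.trans (le_add_of_nonneg_right h0)
  · rw [indicator_of_mem (subset_toMeasurable _ _ hqS)]
    exact hq.trans (le_add_of_nonneg_left (abs_nonneg _))

/-! ### Functions that are smooth on the edges -/

section Smooth

variable {f : G.Point → ℝ} {e : E} {g : ℝ → ℝ}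

theorem derivWithin_of_smooth (hg : Differentiable ℝ g)
    (hfg : ∀ t ∈ Icc 0 (G.len e), f (G.pt e t) = g t) {t : ℝ} (ht : t ∈ Icc 0 (G.len e)) :
    derivWithin (fun t => f (G.pt e t)) (Icc 0 (G.len e)) t = deriv g t := by
  rw [derivWithin_congr hfg (hfg t ht)]
  exact (hg t).derivWithin (uniqueDiffOn_Icc (G.len_pos e) t ht)

theorem edgeDeriv_of_smooth (hfg : ∀ t ∈ Icc 0 (G.len e), f (G.pt e t) = g t) {t : ℝ}
    (ht : t ∈ Ioo 0 (G.len e)) : edgeDeriv (G.comp f) ⟨e, t⟩ = deriv g t := by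
  refine Filter.EventuallyEq.deriv_eq ?_
  filter_upwards [Ioo_mem_nhds ht.1 ht.2] with s hs using hfg s (Ioo_subset_Icc_self hs)

theorem edgeDeriv_edgeDeriv_of_smooth (hfg : ∀ t ∈ Icc 0 (G.len e), f (G.pt e t) = g t) {t : ℝ}
    (ht : t ∈ Ioo 0 (G.len e)) :
    edgeDeriv (edgeDeriv (G.comp f)) ⟨e, t⟩ = deriv (deriv g) t := by
  refine Filter.EventuallyEq.deriv_eq ?_
  filter_upwards [Ioo_mem_nhds ht.1 ht.2] with s hs using edgeDeriv_of_smooth hfg hs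

theorem absolutelyContinuousOnInterval_of_smooth (hg : ContDiff ℝ 2 g)
    (hfg : ∀ t ∈ Icc 0 (G.len e), f (G.pt e t) = g t) :
    AbsolutelyContinuousOnInterval
      (derivWithin (fun t => f (G.pt e t)) (Icc 0 (G.len e))) 0 (G.len e) := by
  have h1 : ContDiff ℝ 1 (deriv g) :=
    (contDiff_succ_iff_deriv.1 (by simpa [one_add_one_eq_two] using hg)).2.2
  refine ContDiffOn.absolutelyContinuousOnInterval ?_
  rw [uIcc_of_le (G.len_pos e).le]
  exact h1.contDiffOn.congr fun t ht =>
    derivWithin_of_smooth (hg.differentiable (by simp)) hfg ht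

end Smooth

/-! ### Cutoff functions -/

variable (G) in
/-- The component on the edge `e` of the cutoff function with the values `ι v` close to the
vertices `v`. -/
noncomputable def edgeCutoff (ι : V → ℝ) (e : E) (t : ℝ) : ℝ :=
  ι (G.src e) + (ι (G.tgt e) - ι (G.src e)) * Real.smoothTransition (3 * (t / G.len e) - 1)

/-- The cutoff function with the values `ι v` close to the vertices `v`. -/
noncomputable def cutoff (ι : V → ℝ) : G.Point → ℝ
  | .vtx v => ι v
  | .inner e t _ => G.edgeCutoff ι e t

/-- The product of a cutoff function with a function on the completion. -/
noncomputable def cutoffMul (ι : V → ℝ) (h : G.Completion → ℝ) (x : G.Point) : ℝ :=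
  cutoff ι x * h x

section Cutoff

variable (ι : V → ℝ)

theorem edgeCutoff_of_le {e : E} {t : ℝ} (ht : t ≤ G.len e / 3) :
    G.edgeCutoff ι e t = ι (G.src e) := by
  have hl := G.len_pos e
  have : t / G.len e ≤ 1 / 3 := by rw [div_le_iff₀ hl]; linarith
  rw [edgeCutoff, Real.smoothTransition.zero_of_nonpos (by linarith), mul_zero, add_zero]

theorem edgeCutoff_of_ge {e : E} {t : ℝ} (ht : G.len e - t ≤ G.len e / 3) :
    G.edgeCutoff ι e t = ι (G.tgt e) := by
  have hl := G.len_pos e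
  have : 2 / 3 ≤ t / G.len e := by rw [le_div_iff₀ hl]; linarith
  rw [edgeCutoff, Real.smoothTransition.one_of_one_le (by linarith)]
  ring

theorem edgeCutoff_of_eq {e : E} (h : ι (G.src e) = ι (G.tgt e)) (t : ℝ) :
    G.edgeCutoff ι e t = ι (G.src e) := by
  rw [edgeCutoff, h]; ring

theorem contDiff_edgeCutoff (e : E) : ContDiff ℝ 2 (G.edgeCutoff ι e) := by
  unfold edgeCutoff
  fun_prop

theorem cutoff_vtx (v : V) : cutoff ι (G.vtx v) = ι v := rfl

theorem cutoff_pt (e : E) (t : ℝ) : cutoff ι (G.pt e t) = G.edgeCutoff ι e t := by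
  have hl := G.len_pos e
  by_cases ht : t ∈ Ioo 0 (G.len e)
  · rw [pt_of_mem_Ioo ht]; rfl
  rcases le_or_gt t 0 with h | h
  · rw [pt_of_nonpos h, cutoff_vtx, edgeCutoff_of_le ι (by linarith)]
  · have : G.len e ≤ t := by
      by_contra! h'
      exact ht ⟨h, h'⟩
    rw [pt_of_len_le this, cutoff_vtx, edgeCutoff_of_ge ι (by linarith)]

theorem cutoffMul_pt (h : G.Completion → ℝ) (e : E) (t : ℝ) :
    cutoffMul ι h (G.pt e t) = G.edgeCutoff ι e t * h (G.cpt e t) := by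
  rw [cutoffMul, cutoff_pt, cpt]

variable {ι}

theorem continuous_cutoff {B : Set E} (hB : B.Finite)
    (hι : ∀ e ∉ B, ι (G.src e) = ι (G.tgt e)) : Continuous (cutoff (G := G) ι) := by
  have hlip : ∀ e, ∃ K : ℝ, 0 ≤ K ∧ ∀ s ∈ Icc 0 (G.len e), ∀ t ∈ Icc 0 (G.len e),
      |G.edgeCutoff ι e s - G.edgeCutoff ι e t| ≤ K * |s - t| := by
    intro e
    obtain ⟨K, hK⟩ := ((contDiff_edgeCutoff (G := G) ι e).contDiffOn
      (s := Icc 0 (G.len e))).exists_lipschitzOnWith (by simp) (convex_Icc _ _) isCompact_Icc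
    exact ⟨K, K.2, fun s hs t ht => by simpa [Real.dist_eq] using hK.dist_le_mul s hs t ht⟩
  choose K hK0 hK using hlip
  obtain ⟨M, hM⟩ := (hB.image K).bddAbove
  refine continuous_of_edgewise_lipschitz (K := max M 0) (le_max_right _ _)
    fun e s hs t ht => ?_
  rw [cutoff_pt, cutoff_pt]
  by_cases he : e ∈ B
  · refine (hK e s hs t ht).trans (mul_le_mul_of_nonneg_right ?_ (abs_nonneg _))
    exact (hM ⟨e, he, rfl⟩).trans (le_max_left _ _)
  · rw [edgeCutoff_of_eq ι (hι e he), edgeCutoff_of_eq ι (hι e he), sub_self, abs_zero]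
    positivity

/-- Close to the boundary the cutoff function takes its values at the vertices. -/
theorem cutoff_near_boundary {B : Set E} (hι : ∀ e ∉ B, ι (G.src e) = ι (G.tgt e)) {ε : ℝ}
    (hε : ∀ e ∈ B, ε ≤ G.len e / 3) {p : G.Completion} (hp : p ∈ G.boundary) {x : G.Point}
    (hx : dist (x : G.Completion) p < ε) :
    ∃ v, dist ((G.vtx v : G.Point) : G.Completion) p < ε ∧ cutoff ι x = ι v := by
  rcases x with v | ⟨e, t, ht⟩
  · exact ⟨v, hx, rfl⟩
  have hpt := pt_of_mem_Ioo ht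
  rw [← hpt] at hx ⊢
  rw [cutoff_pt]
  rcases exists_end_near hp (Ioo_subset_Icc_self ht) hx with h | h
  · rw [cpt_zero] at h
    refine ⟨G.src e, by linarith [ht.1], ?_⟩
    by_cases he : e ∈ B
    · refine edgeCutoff_of_le ι ?_
      linarith [hε e he, dist_nonneg (x := ((G.vtx (G.src e) : G.Point) : G.Completion)) (y := p)]
    · exact edgeCutoff_of_eq ι (hι e he) t
  · rw [cpt_len] at h
    refine ⟨G.tgt e, by linarith [ht.2], ?_⟩
    by_cases he : e ∈ B
    · refine edgeCutoff_of_ge ι ?_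
      linarith [hε e he, dist_nonneg (x := ((G.vtx (G.tgt e) : G.Point) : G.Completion)) (y := p)]
    · rw [edgeCutoff_of_eq ι (hι e he) t, hι e he]

/-- The product of a cutoff function with a harmonic function satisfies the Kirchhoff
conditions. -/
theorem vertexFlux_cutoffMul {h : G.Completion → ℝ} (hh : G.IsHarmonic h)
    (hι : ∀ v, ι v = 0 ∨ ι v = 1) {v : V} (hv : v ∉ G.bdry) :
    G.vertexFlux (cutoffMul ι h) v = 0 := by
  -- The cutoff is constant on the outer thirds of an edge, so near each vertex v the product is ι v
  -- times h.
  have hsrc : ∀ e, G.srcDeriv (cutoffMul ι h) e =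
      ι (G.src e) * G.srcDeriv (fun x => h x) e := by
    intro e
    obtain ⟨a, b, hab⟩ := hh.affine e
    rw [srcDeriv_of_affine_near (f := fun x => h x) (a := a) (b := b) one_pos
      fun t ht _ => hab t ht]
    refine srcDeriv_of_affine_near (a := ι (G.src e) * a) (div_pos (G.len_pos e) three_pos)
      fun t ht ht' => ?_
    rw [cutoffMul_pt, edgeCutoff_of_le ι ht'.le, hab t ht]
    ring
  have htgt : ∀ e, G.tgtDeriv (cutoffMul ι h) e =
      ι (G.tgt e) * G.tgtDeriv (fun x => h x) e := by
    intro e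
    obtain ⟨a, b, hab⟩ := hh.affine e
    rw [tgtDeriv_of_affine_near (f := fun x => h x) (a := a) (b := b) one_pos
      fun t ht _ => hab t ht]
    refine tgtDeriv_of_affine_near (a := ι (G.tgt e) * a) (div_pos (G.len_pos e) three_pos)
      fun t ht ht' => ?_
    rw [cutoffMul_pt, edgeCutoff_of_ge ι ht'.le, hab t ht]
    ring
  have hflux : G.vertexFlux (cutoffMul ι h) v =
      (∑ᶠ (e : E) (_ : G.src e = v), ι v * G.srcDeriv (fun x => h x) e) -
        ∑ᶠ (e : E) (_ : G.tgt e = v), ι v * G.tgtDeriv (fun x => h x) e := by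
    refine congrArg₂ _ (finsum_congr fun e => finsum_congr fun he => ?_)
      (finsum_congr fun e => finsum_congr fun he => ?_)
    · rw [← he]; exact hsrc e
    · rw [← he]; exact htgt e
  rw [hflux]
  rcases hι v with h0 | h1
  · simp [h0]
  · simp only [h1, one_mul]
    exact hh.kirchhoff v hv

end Cutoff

/-! ### Cutoffs of harmonic functions in the maximal domain -/

section CutoffMul

variable {ι : V → ℝ} {B : Set E} {h : G.Completion → ℝ}

theorem cutoffMul_pt_of_affine (ι : V → ℝ) {e : E} {a b : ℝ}
    (hab : ∀ t ∈ Icc 0 (G.len e), h (G.cpt e t) = a + b * t) :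
    ∀ t ∈ Icc 0 (G.len e), cutoffMul ι h (G.pt e t) = G.edgeCutoff ι e t * (a + b * t) :=
  fun t ht => by rw [cutoffMul_pt, hab t ht]

theorem contDiff_edgeCutoff_mul (ι : V → ℝ) (e : E) (a b : ℝ) :
    ContDiff ℝ 2 fun t => G.edgeCutoff ι e t * (a + b * t) :=
  (contDiff_edgeCutoff ι e).mul (by fun_prop)

theorem exists_bound_on_edges (hB : B.Finite) {u : E → ℝ → ℝ}
    (hu : ∀ e, Continuous (u e)) :
    ∃ M, 0 ≤ M ∧ ∀ e ∈ B, ∀ t ∈ Icc 0 (G.len e), |u e t| ≤ M := by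
  refine hB.exists_forall_le_of_forall_exists (u := fun e t => |u e t|) fun e _ => ?_
  obtain ⟨M, hM⟩ := isCompact_Icc.exists_bound_of_continuousOn (hu e).continuousOn
  exact ⟨M, hM⟩

/-- Off the finite set B the function is 0 or h on each edge: it is affine there, so its second
derivative lives on B. The function itself is bounded, as h is by compactness, and lives on B and a
set of finite volume. -/
theorem memDMax_cutoffMul [Countable V] [CompactSpace G.Completion] (hh : G.IsHarmonic h)
    (hι : ∀ v, ι v = 0 ∨ ι v = 1) (hB : B.Finite)
    (hιB : ∀ e ∉ B, ι (G.src e) = ι (G.tgt e)) {A : Set G.Completion} (hA : G.vol A < ⊤)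
    (hιA : ∀ e ∉ B, ι (G.src e) = 1 → ∀ t ∈ Icc 0 (G.len e), G.cpt e t ∈ A) :
    G.MemDMax (cutoffMul ι h) := by
  choose a b hab using hh.affine
  have hcont : Continuous (cutoffMul (G := G) ι h) :=
    (continuous_cutoff hB hιB).mul (hh.continuous.comp (UniformSpace.Completion.continuous_coe _))
  have hg := fun e => contDiff_edgeCutoff_mul (G := G) ι e (a e) (b e)
  have hfg := fun e => cutoffMul_pt_of_affine ι (hab e)
  refine ⟨hcont, fun e => ?_, fun e => ?_, ?_, ?_, fun v hv => vertexFlux_cutoffMul hh hι hv⟩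
  · exact ((hg e).differentiable (by simp)).differentiableOn.congr (hfg e)
  · exact absolutelyContinuousOnInterval_of_smooth (hg e) (hfg e)
  · obtain ⟨K, hK⟩ := isCompact_univ.exists_bound_of_continuousOn hh.continuous.continuousOn
    obtain ⟨M, hM0, hM⟩ := exists_bound_on_edges hB fun e => (hg e).continuous
    refine memLp_of_le_add_indicator (measurable_comp hcont) (MemLp.zero (p := 2))
      (S := {q | G.cpt q.1 q.2 ∈ A} ∪ {q | q.1 ∈ B}) (M := max K M)
      (measure_union_lt_top hA (edgeMeasure_edges_lt_top hB)) (hM0.trans (le_max_right _ _))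
      (ae_edgeMeasure_of_forall fun e t ht => ?_)
    have htI := Ioo_subset_Icc_self ht
    change |cutoffMul ι h (G.pt e t)| ≤ _ ∨ _ ∧ |cutoffMul ι h (G.pt e t)| ≤ _
    by_cases he : e ∈ B
    · right
      rw [hfg e t htI]
      exact ⟨.inr he, (hM e he t htI).trans (le_max_right _ _)⟩
    · rw [cutoffMul_pt, edgeCutoff_of_eq ι (hιB e he)]
      rcases hι (G.src e) with h0 | h1
      · left; simp [h0]
      · right
        refine ⟨.inl (hιA e he h1 t htI), ?_⟩
        rw [h1, one_mul]
        exact (hK _ (mem_univ _)).trans (le_max_left _ _)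
  · have hg2 : ∀ e, Continuous (deriv (deriv fun t => G.edgeCutoff ι e t * (a e + b e * t))) :=
      fun e => ((contDiff_succ_iff_deriv.1
        (by simpa [one_add_one_eq_two] using hg e)).2.2 : ContDiff ℝ 1 _).continuous_deriv le_rfl
    obtain ⟨M, hM0, hM⟩ := exists_bound_on_edges hB hg2
    refine memLp_of_le_add_indicator (measurable_edgeDeriv _) (MemLp.zero (p := 2))
      (S := {q | q.1 ∈ B}) (M := M) (edgeMeasure_edges_lt_top hB) hM0
      (ae_edgeMeasure_of_forall fun e t ht => ?_)
    by_cases he : e ∈ B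
    · right
      refine ⟨he, ?_⟩
      rw [edgeDeriv_edgeDeriv_of_smooth (hfg e) ht]
      exact hM e he t (Ioo_subset_Icc_self ht)
    · left
      rw [edgeDeriv_edgeDeriv_of_affine (a := ι (G.src e) * a e) (b := ι (G.src e) * b e) ?_ ht]
      · simp
      · intro t ht
        rw [hfg e t ht, edgeCutoff_of_eq ι (hιB e he)]
        ring

/-- The derivative is bounded on the finitely many edges of B and is 0 or h' elsewhere, where finite
energy applies. -/
theorem memLp_deriv_cutoffMul [Countable V] (hh : G.IsHarmonic h) (hh' : G.MemH1 h)
    (hι : ∀ v, ι v = 0 ∨ ι v = 1) (hB : B.Finite)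
    (hιB : ∀ e ∉ B, ι (G.src e) = ι (G.tgt e)) :
    MemLp (edgeDeriv (G.comp (cutoffMul ι h))) 2 G.edgeMeasure := by
  choose a b hab using hh.affine
  have hg := fun e => contDiff_edgeCutoff_mul (G := G) ι e (a e) (b e)
  have hfg := fun e => cutoffMul_pt_of_affine ι (hab e)
  obtain ⟨M, hM0, hM⟩ := exists_bound_on_edges hB fun e =>
    (hg e).continuous_deriv (by norm_num)
  refine memLp_of_le_add_indicator (measurable_edgeDeriv _) hh'.memLp_deriv
    (S := {q | q.1 ∈ B}) (M := M) (edgeMeasure_edges_lt_top hB) hM0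
    (ae_edgeMeasure_of_forall fun e t ht => ?_)
  by_cases he : e ∈ B
  · right
    refine ⟨he, ?_⟩
    rw [edgeDeriv_of_smooth (hfg e) ht]
    exact hM e he t (Ioo_subset_Icc_self ht)
  · left
    rw [edgeDeriv_of_affine (a := ι (G.src e) * a e) (b := ι (G.src e) * b e) ?_ ht,
      edgeDeriv_of_affine (f := fun x => h x) (hab e) ht]
    · rcases hι (G.src e) with h0 | h1
      · simp [h0]
      · simp [h1]
    · intro t ht
      rw [hfg e t ht, edgeCutoff_of_eq ι (hιB e he)]
      ring

end CutoffMul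

/-- There is a function in the domain that agrees with `k n` close to `F n`. -/
theorem exists_mem_domain_eq [Countable V] [CompactSpace G.Completion] {N : ℕ} {δ : ℝ}
    {F₀ : Set G.Completion} {F : Fin N → Set G.Completion} (hF : G.IsInitialPartition F₀ F δ)
    {k : Fin N → G.Completion → ℝ} {C : Fin N → ℝ}
    (hk : ∀ n, G.IsRobinFunction (k n) (F n) (C n)) (n : Fin N) (Q : Set (Set G.Completion)) :
    ∃ f ∈ G.domain δ F₀ F k Q, G.MemDMax f ∧ MemLp (edgeDeriv (G.comp f)) 2 G.edgeMeasure ∧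
      ∃ ε > 0, ∀ x : G.Point, (x : G.Completion) ∈ Metric.thickening ε (F n) → f x = k n x := by
  classical
  have hδ := hF.pos
  have hr : δ / 3 ≤ δ := by linarith
  set ι : V → ℝ := fun v =>
    if ((G.vtx v : G.Point) : G.Completion) ∈ Metric.thickening (δ / 3) (F n) then 1 else 0
    with hιdef
  have hι : ∀ v, ι v = 0 ∨ ι v = 1 := fun v => by
    simp only [hιdef]; split_ifs <;> simp
  have hB : (G.farEdges (δ / 3)).Finite := finite_farEdges (by positivity)
  -- Since δ/3 + 2δ/3 = δ, a short edge that meets the δ/3-neighborhood of F n stays in its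
  -- δ-neighborhood, and then, being close to the boundary, in the smaller one. Hence ι changes only
  -- along far edges.
  have hnear : ∀ e ∉ G.farEdges (δ / 3), ∀ s ∈ Icc 0 (G.len e),
      G.cpt e s ∈ Metric.thickening (δ / 3) (F n) → ∀ t ∈ Icc 0 (G.len e),
      G.cpt e t ∈ Metric.thickening δ (F n) ∧ G.cpt e t ∈ Metric.thickening (δ / 3) (F n) := by
    intro e he s hs hsF t ht
    obtain ⟨p, hp, hd⟩ := Metric.mem_thickening_iff.1 hsF
    have h1 := len_lt_of_notMem_farEdges he
    have h2 : |t - s| ≤ G.len e := by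
      rw [abs_le]; constructor <;> linarith [ht.1, ht.2, hs.1, hs.2]
    have h3 := dist_cpt_le e ht hs
    have h4 := dist_triangle (G.cpt e t) (G.cpt e s) p
    have h5 : G.cpt e t ∈ Metric.thickening δ (F n) :=
      Metric.mem_thickening_iff.2 ⟨p, hp, by linarith⟩
    refine ⟨h5, hF.mem_thickening_of_boundary le_rfl hr h5 ?_⟩
    by_contra hcon
    exact he ⟨t, ht, hcon⟩
  have hιB : ∀ e ∉ G.farEdges (δ / 3), ι (G.src e) = ι (G.tgt e) := by
    intro e he
    have hl := (G.len_pos e).le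
    have : G.cpt e 0 ∈ Metric.thickening (δ / 3) (F n) ↔
        G.cpt e (G.len e) ∈ Metric.thickening (δ / 3) (F n) :=
      ⟨fun h => (hnear e he 0 (left_mem_Icc.2 hl) h _ (right_mem_Icc.2 hl)).2,
        fun h => (hnear e he _ (right_mem_Icc.2 hl) h 0 (left_mem_Icc.2 hl)).2⟩
    rw [cpt_zero, cpt_len] at this
    simp only [hιdef, this]
  have hιA : ∀ e ∉ G.farEdges (δ / 3), ι (G.src e) = 1 → ∀ t ∈ Icc 0 (G.len e),
      G.cpt e t ∈ Metric.thickening δ (F n) := by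
    intro e he h1 t ht
    have : G.cpt e 0 ∈ Metric.thickening (δ / 3) (F n) := by
      by_contra hcon
      rw [cpt_zero] at hcon
      simp [hιdef, hcon] at h1
    exact (hnear e he 0 (left_mem_Icc.2 (G.len_pos e).le) this t ht).1
  have hmem := memDMax_cutoffMul (hk n).harmonic hι hB hιB (hF.finite_vol n) hιA
  obtain ⟨ρ, hρ, hρle⟩ := hB.exists_pos_forall_le (f := fun e => G.len e / 3)
    fun e _ => div_pos (G.len_pos e) three_pos
  set ε := min (δ / 3) ρ
  have hε : 0 < ε := lt_min (by positivity) hρ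
  have hεδ : ε ≤ δ / 3 := min_le_left _ _
  have hεB : ∀ e ∈ G.farEdges (δ / 3), ε ≤ G.len e / 3 := fun e he =>
    (min_le_right _ _).trans (hρle e he)
  have hone : ∀ x : G.Point, (x : G.Completion) ∈ Metric.thickening ε (F n) →
      cutoff ι x = 1 := by
    intro x hx
    obtain ⟨p, hp, hd⟩ := Metric.mem_thickening_iff.1 hx
    obtain ⟨v, hv, hvx⟩ := cutoff_near_boundary hιB hεB (hF.subset_boundary n hp) hd
    rw [hvx]
    exact if_pos (Metric.mem_thickening_iff.2 ⟨p, hp, hv.trans_le hεδ⟩)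
  have hzero : ∀ A ⊆ G.boundary, Disjoint (Metric.thickening δ A) (Metric.thickening δ (F n)) →
      ∀ x : G.Point, (x : G.Completion) ∈ Metric.thickening ε A → cutoff ι x = 0 := by
    intro A hA hdisj x hx
    obtain ⟨p, hp, hd⟩ := Metric.mem_thickening_iff.1 hx
    obtain ⟨v, hv, hvx⟩ := cutoff_near_boundary hιB hεB (hA hp) hd
    rw [hvx]
    refine if_neg fun hvF => disjoint_left.1 hdisj
      (Metric.mem_thickening_iff.2 ⟨p, hp, hv.trans_le (hεδ.trans hr)⟩)
      (Metric.thickening_mono hr _ hvF)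
  refine ⟨cutoffMul ι (k n), ⟨hmem, ε, hε, by linarith, fun x hx => ?_,
    fun A _ m hAm => ?_⟩, hmem,
    memLp_deriv_cutoffMul (hk n).harmonic (hk n).finiteEnergy hι hB hιB, ε, hε, fun x hx => ?_⟩
  · rw [cutoffMul, hzero F₀ hF.clopen_zero.1 (hF.disjoint_zero n) x hx, zero_mul]
  · by_cases hmn : m = n
    · subst hmn
      exact ⟨1, fun x hx => by rw [cutoffMul, hone x (Metric.thickening_subset_of_subset ε hAm hx)]⟩
    -- Near the other pieces the cutoff vanishes, and 0 is a multiple of k m.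
    · refine ⟨0, fun x hx => ?_⟩
      rw [cutoffMul, hzero (F m) (hF.subset_boundary m) (hF.disjoint m n hmn) x
        (Metric.thickening_subset_of_subset ε hAm hx), zero_mul, zero_mul]
  · rw [cutoffMul, hone x hx, one_mul]

end MetricGraph

/-! ### Conclusion -/

theorem theorem4p3 {V : Type*} {E : Type*} [Countable V] (G : MetricGraph V E)
    (hcompact : CompactSpace G.Completion) (hdisc : IsTotallyDisconnected G.boundary)
    {N : ℕ} (hN : 1 ≤ N) (δ : ℝ) (F₀ : Set G.Completion) (F : Fin N → Set G.Completion)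
    (hF : G.IsInitialPartition F₀ F δ)
    (k : Fin N → G.Completion → ℝ) (C : Fin N → ℝ)
    (hk : ∀ n, G.IsRobinFunction (k n) (F n) (C n))
    (P : ℕ → Set (Set G.Completion)) (hP : G.IsPartitionSequence F₀ F P) :
    (∀ j, G.IsNonnegOp (G.operatorOn (G.domain δ F₀ F k (P j)))) ∧
    G.IsNonnegOp (G.operatorOn (⋃ j, G.domain δ F₀ F k (P j))) ∧
    ∀ j, ∃ f ∈ G.domain δ F₀ F k (P j), ∃ hf : G.MemDMax f,
      MemLp (edgeDeriv (G.comp f)) 2 G.edgeMeasure ∧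
      ∫ q, (edgeDeriv (G.comp f) q) ^ 2 ∂G.edgeMeasure < inner ℝ (G.negD2 hf) (G.toL2 hf) := by
  have hnonneg := fun j => MetricGraph.isNonnegOp_domain hF hk hP j
  refine ⟨hnonneg, ?_, fun j => ?_⟩
  · rintro _ ⟨f, hfD, hf, rfl⟩
    obtain ⟨j, hj⟩ := mem_iUnion.1 hfD
    exact hnonneg j _ ⟨f, hj, hf, rfl⟩
  · obtain ⟨f, hfD, hf, hf', ε, hε, hfk⟩ :=
      MetricGraph.exists_mem_domain_eq hF hk ⟨0, hN⟩ (P j)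
    exact ⟨f, hfD, hf, hf', MetricGraph.lt_inner_of_eq_boundary_function hF hk hP hfD hf hf' hε hfk⟩
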